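/- A $b$-coloring of a finite simple graph $G$ with $k$ colors is a proper coloring $V(G)\to\{1,\dots,k\}$ such that for every color $i$ there is a vertex $x$ of color $i$ that has, for each color $j\neq i$, a neighbor of color $j$. The problem $b$-Coloring asks, given $G$ and an integer $k\ge 0$, whether $G$ has a $b$-coloring with $k$ colors. Let $n$ be the number of vertices of $G$, let $\Delta=\Delta(G)$ be its maximum degree, and let $\ell=\ell_k(G)$ be the number of vertices of $G$ of degree at least $k$. **Theorem.** $b$-Coloring is fixed-parameter tractable parameterized by $\Delta(G)+\ell_k(G)$: it can be decided in time $f(\Delta+\ell)\cdot N^{O(1)}$ for some computable function $f$, where $N$ is the length of the input. More precisely, there is an algorithm that, given $G$ and $k$, decides whether $G$ has a $b$-coloring with $k$ colors in time $$2^{O(\ell\cdot\Delta\cdot\min\{\ell,\Delta\}^{\ell+1})}+n^{O(1)}\quad\text{if } \ell>k,$$ $$2^{O(\min\{k,\Delta+1\}^4\cdot\Delta)}+n^{O(1)}\quad\text{if } \ell\le k.$$ (Algorithms are programs of a random access machine with addition and subtraction at unit cost; $n^{O(1)}$ is read as $(n+2)^{c}$ for a constant $c$, so that it also makes sense for $n\le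 1$.) -/

import Mathlib

/-! ## Random access machines

Structured programs for a uniform-cost random access machine.  The machine has registers and
arrays holding natural numbers (a program mentions only finitely many of them; they are addressed
by constants), array cells are addressed indirectly through registers, and the arithmetic is
restricted to addition and truncated subtraction, so that the model is polynomially equivalent to
Turing machines.  Every instruction and every test costs one step. -/

namespace RAM

/-- A memory configuration: `reg r` is the content of register `r`, and `arr a i` is the content
of cell `i` of array `a`. -/
structure State where
  reg : ℕ → ℕ
  arr : ℕ → ℕ → ℕ

/-- The state after the assignment of the value `v` to register `r`. -/
def State.setReg (s : State) (r v : ℕ) : State :=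
  { s with reg := Function.update s.reg r v }

/-- The state after the assignment of the value `v` to cell `i` of array `a`. -/
def State.setArr (s : State) (a i v : ℕ) : State :=
  { s with arr := Function.update s.arr a (Function.update (s.arr a) i v) }

/-- Programs. All arguments of type `ℕ` are names of registers, except `v` (a constant) and `a`
(the name of an array). -/
inductive Program where
  /-- do nothing -/
  | skip : Program
  /-- `r := v` for a constant `v` -/
  | const (r v : ℕ) : Program
  /-- `r := x` -/
  | copy (r x : ℕ) : Program
  /-- `r := x + y` -/
  | add (r x y : ℕ) : Program
  /-- `r := max (x - y) 0` -/
  | sub (r x y : ℕ) : Program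
  /-- `r := a[x]` -/
  | load (r a x : ℕ) : Program
  /-- `a[x] := y` -/
  | store (a x y : ℕ) : Program
  /-- `p; q` -/
  | seq (p q : Program) : Program
  /-- `if x < y then p else q` -/
  | ifLt (x y : ℕ) (p q : Program) : Program
  /-- `while x < y do p` -/
  | whileLt (x y : ℕ) (p : Program) : Program

/-- `Runs p s s' t`: started in the state `s`, the program `p` halts in the state `s'` after
exactly `t` steps. -/
inductive Runs : Program → State → State → ℕ → Prop where
  | skip (s : State) : Runs .skip s s 1
  | const (s : State) (r v : ℕ) : Runs (.const r v) s (s.setReg r v) 1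
  | copy (s : State) (r x : ℕ) : Runs (.copy r x) s (s.setReg r (s.reg x)) 1
  | add (s : State) (r x y : ℕ) : Runs (.add r x y) s (s.setReg r (s.reg x + s.reg y)) 1
  | sub (s : State) (r x y : ℕ) : Runs (.sub r x y) s (s.setReg r (s.reg x - s.reg y)) 1
  | load (s : State) (r a x : ℕ) : Runs (.load r a x) s (s.setReg r (s.arr a (s.reg x))) 1
  | store (s : State) (a x y : ℕ) : Runs (.store a x y) s (s.setArr a (s.reg x) (s.reg y)) 1
  | seq {p q : Program} {s₁ s₂ s₃ : State} {t₁ t₂ : ℕ} (hp : Runs p s₁ s₂ t₁)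
      (hq : Runs q s₂ s₃ t₂) : Runs (.seq p q) s₁ s₃ (t₁ + t₂)
  | ifTrue {x y : ℕ} {p q : Program} {s s' : State} {t : ℕ} (h : s.reg x < s.reg y)
      (hp : Runs p s s' t) : Runs (.ifLt x y p q) s s' (t + 1)
  | ifFalse {x y : ℕ} {p q : Program} {s s' : State} {t : ℕ} (h : ¬ s.reg x < s.reg y)
      (hq : Runs q s s' t) : Runs (.ifLt x y p q) s s' (t + 1)
  | whileTrue {x y : ℕ} {p : Program} {s₁ s₂ s₃ : State} {t₁ t₂ : ℕ} (h : s₁.reg x < s₁.reg y)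
      (hp : Runs p s₁ s₂ t₁) (hw : Runs (.whileLt x y p) s₂ s₃ t₂) :
      Runs (.whileLt x y p) s₁ s₃ (t₁ + t₂ + 1)
  | whileFalse {x y : ℕ} {p : Program} {s : State} (h : ¬ s.reg x < s.reg y) :
      Runs (.whileLt x y p) s s 1

/-- Started in the state `s`, the program `p` halts after at most `T` steps, with the answer `1`
in register `0` if `Q` holds and the answer `0` there if `Q` fails. -/
def DecidesInTime (p : Program) (s : State) (Q : Prop) (T : ℕ) : Prop :=
  ∃ (s' : State) (t : ℕ), Runs p s s' t ∧ t ≤ T ∧ (Q → s'.reg 0 = 1) ∧ (¬ Q → s'.reg 0 = 0)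

/-- Fixed-parameter tractability of the problem "does `Q x` hold?" on instances `x : α`, where
`input x` is the initial memory holding the instance, `length x` is its length and `param x` is
its parameter. -/
def IsFPT {α : Type*} (input : α → State) (length param : α → ℕ) (Q : α → Prop) : Prop :=
  ∃ (p : Program) (f : ℕ → ℕ) (c : ℕ), Computable f ∧
    ∀ x : α, DecidesInTime p (input x) (Q x) (f (param x) * length x ^ c)

end RAM

/-! ## The problem -/

/-- `G` admits a `b`-coloring with `k` colors: a proper coloring in which every color `i` has a
vertex `x` of color `i` with a neighbor in each of the other color classes. -/
def HasBColoring {V : Type*} (G : SimpleGraph V) (k : ℕ) : Prop :=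
  ∃ C : G.Coloring (Fin k), ∀ i : Fin k, ∃ x : V, C x = i ∧
    ∀ j : Fin k, j ≠ i → ∃ y : V, G.Adj x y ∧ C y = j

open Classical in
/-- The maximum degree `Δ(G)`. -/
noncomputable def maxDeg {V : Type*} [Fintype V] (G : SimpleGraph V) : ℕ :=
  G.maxDegree

open Classical in
/-- The number `ℓ_k(G)` of vertices of degree at least `k`. -/
noncomputable def numHighDeg {V : Type*} [Fintype V] (G : SimpleGraph V) (k : ℕ) : ℕ :=
  (Finset.univ.filter fun v : V => k ≤ G.degree v).card

/-- An instance of `b`-Coloring: a finite simple graph with vertices `0, …, n - 1`, and the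
number `k` of colors. -/
structure BInstance where
  n : ℕ
  G : SimpleGraph (Fin n)
  k : ℕ

namespace BInstance

open Classical in
/-- The initial memory: register `0` holds `n`, register `1` holds `k`, and array `0` holds the
adjacency matrix, row by row, with the entry for `(i, j)` in cell `i * n + j`. Everything else
is `0`. -/
noncomputable def input (I : BInstance) : RAM.State where
  reg r := if r = 0 then I.n else if r = 1 then I.k else 0
  arr a m := if a = 0 ∧ ∃ i j : Fin I.n, I.G.Adj i j ∧ m = i * I.n + j then 1 else 0

/-- The length of an instance: the bits of the adjacency matrix, the bits of `k`, and an
end marker. -/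
def length (I : BInstance) : ℕ := I.n ^ 2 + Nat.size I.k + 1

end BInstance

/-!
A vertex of degree less than `k - 1` cannot be the center of a color, and the vertices of degree
less than `k` can be colored greedily at the end. If there are at least `(ℓ + k) (Δ + 1) ^ 3` tight
vertices, that is, vertices of degree exactly `k - 1`, then `k` of them can be chosen so far from
each other and from the vertices of degree at least `k` that a proper coloring of the latter stays
proper when the chosen vertices and their neighbors are recolored into centers of all colors.
Hence it suffices to consider that many tight vertices as centers, besides the `ℓ` vertices of
degree at least `k`, and to search for the colors of the latter, for a center of each color, and for
the neighbors of the centers. The size of this search space is `2 ^ O(X) * n ^ O(1)` for the stated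
exponent `X`, and a random access machine carries out the search in time polynomial in that size,
as bounded quantification over numbers of this size costs only a factor of this size. The product
becomes a sum by `x * y ≤ x ^ 2 + y ^ 2`.
-/

namespace RAM

@[simp]
theorem State.reg_setReg_self (s : State) (r v : ℕ) : (s.setReg r v).reg r = v := by
  simp [State.setReg]

@[simp]
theorem State.reg_setReg_of_ne {r r' : ℕ} (h : r' ≠ r) (s : State) (v : ℕ) :
    (s.setReg r v).reg r' = s.reg r' := by
  simp [State.setReg, h]

/-- Started in the state `s`, the program `p` halts in the state `s'` after at most `T` steps. -/
def RunsWithin (p : Program) (s s' : State) (T : ℕ) : Prop :=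
  ∃ t ≤ T, Runs p s s' t

theorem DecidesInTime.mono {p : Program} {s : State} {Q : Prop} {T U : ℕ}
    (h : DecidesInTime p s Q T) (hTU : T ≤ U) : DecidesInTime p s Q U :=
  let ⟨s', t, hrun, ht, hQ⟩ := h
  ⟨s', t, hrun, ht.trans hTU, hQ⟩

theorem Runs.runsWithin {p : Program} {s s' : State} {t : ℕ} (h : Runs p s s' t) :
    RunsWithin p s s' t :=
  ⟨t, le_rfl, h⟩

namespace RunsWithin

variable {p q : Program} {s s₁ s₂ s₃ s' : State} {T T₁ T₂ x y : ℕ}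

theorem mono (h : RunsWithin p s s' T₁) (hT : T₁ ≤ T₂) : RunsWithin p s s' T₂ :=
  let ⟨t, ht, hp⟩ := h
  ⟨t, ht.trans hT, hp⟩

theorem seq (hp : RunsWithin p s₁ s₂ T₁) (hq : RunsWithin q s₂ s₃ T₂) :
    RunsWithin (.seq p q) s₁ s₃ (T₁ + T₂) :=
  let ⟨_, ht₁, hp⟩ := hp
  let ⟨_, ht₂, hq⟩ := hq
  ⟨_, add_le_add ht₁ ht₂, hp.seq hq⟩

theorem ifTrue (h : s.reg x < s.reg y) (hp : RunsWithin p s s' T) :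
    RunsWithin (.ifLt x y p q) s s' (T + 1) :=
  let ⟨_, ht, hp⟩ := hp
  ⟨_, Nat.succ_le_succ ht, .ifTrue h hp⟩

theorem ifFalse (h : ¬ s.reg x < s.reg y) (hq : RunsWithin q s s' T) :
    RunsWithin (.ifLt x y p q) s s' (T + 1) :=
  let ⟨_, ht, hq⟩ := hq
  ⟨_, Nat.succ_le_succ ht, .ifFalse h hq⟩

theorem whileTrue (h : s₁.reg x < s₁.reg y) (hp : RunsWithin p s₁ s₂ T₁)
    (hw : RunsWithin (.whileLt x y p) s₂ s₃ T₂) :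
    RunsWithin (.whileLt x y p) s₁ s₃ (T₁ + T₂ + 1) :=
  let ⟨_, ht₁, hp⟩ := hp
  let ⟨_, ht₂, hw⟩ := hw
  ⟨_, Nat.succ_le_succ (add_le_add ht₁ ht₂), .whileTrue h hp hw⟩

theorem whileLt_of_invariant {m : ℕ} (Inv : ℕ → State → Prop)
    (step : ∀ i < m, ∀ s, Inv i s →
      s.reg x < s.reg y ∧ ∃ s', RunsWithin p s s' T ∧ Inv (i + 1) s')
    (exit : ∀ s, Inv m s → ¬ s.reg x < s.reg y) (hs : Inv 0 s) :
    ∃ s', RunsWithin (.whileLt x y p) s s' (m * (T + 1) + 1) ∧ Inv m s' := by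
  induction m generalizing Inv s with
  | zero => exact ⟨s, (Runs.whileFalse (exit s hs)).runsWithin.mono (by omega), hs⟩
  | succ m ih =>
    obtain ⟨hlt, s₁, hp, hs₁⟩ := step 0 m.succ_pos s hs
    obtain ⟨s', hw, hs'⟩ := ih (fun i => Inv (i + 1))
      (fun i hi => step (i + 1) (Nat.succ_lt_succ hi)) exit hs₁
    exact ⟨s', (whileTrue hlt hp hw).mono (by rw [Nat.succ_mul]; omega), hs'⟩

end RunsWithin

/-- The states `s` and `s'` agree, except possibly in the registers from `d` on. These registers
are the workspace of a computation started in `s`. -/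
structure State.AgreeBelow (d : ℕ) (s s' : State) : Prop where
  reg_eq : ∀ r < d, s'.reg r = s.reg r
  arr_eq : s'.arr = s.arr

namespace State.AgreeBelow

variable {d e : ℕ} {s s' s'' : State}

theorem refl (d : ℕ) (s : State) : s.AgreeBelow d s :=
  ⟨fun _ _ => rfl, rfl⟩

theorem trans (h : s.AgreeBelow d s') (h' : s'.AgreeBelow d s'') : s.AgreeBelow d s'' :=
  ⟨fun r hr => (h'.reg_eq r hr).trans (h.reg_eq r hr), h'.arr_eq.trans h.arr_eq⟩

theorem mono (h : s.AgreeBelow e s') (hd : d ≤ e) : s.AgreeBelow d s' :=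
  ⟨fun r hr => h.reg_eq r (hr.trans_le hd), h.arr_eq⟩

theorem setReg (h : s.AgreeBelow d s') {r : ℕ} (hr : d ≤ r) (v : ℕ) :
    s.AgreeBelow d (s'.setReg r v) :=
  ⟨fun r' hr' => by rw [reg_setReg_of_ne (hr'.trans_le hr).ne, h.reg_eq r' hr'], h.arr_eq⟩

end State.AgreeBelow

/-- Data that a program can access: every `x : α` is represented by the values of the variables
`Var` and by the cells of array `0`. Running times and values are measured in `bound x`. -/
class Environment (α : Type*) where
  Var : Type
  value : α → Var → ℕ
  cells : α → ℕ → ℕ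
  bound : α → ℕ
  two_le_bound : ∀ x, 2 ≤ bound x

open Environment

/-- An environment extended by one variable, which is named `none`. -/
instance Environment.prodNat {α : Type*} [Environment α] : Environment (α × ℕ) where
  Var := Option (Var α)
  value x i := i.elim x.2 (value x.1)
  cells x := cells x.1
  bound x := max (bound x.1) x.2
  two_le_bound x := (two_le_bound x.1).trans (le_max_left _ _)

variable {α β : Type*} [Environment α] [Environment β]

/-- In the state `s`, the value of the variable `i` of `x` is in register `loc i`, and array `0`
has the cells of `x`. -/
structure Stores (loc : Var α → ℕ) (x : α) (s : State) : Prop where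
  reg_eq : ∀ i, s.reg (loc i) = value x i
  arr_eq : s.arr 0 = cells x

theorem Stores.of_agreeBelow {loc : Var α → ℕ} {x : α} {s s' : State} {d : ℕ}
    (hs : Stores loc x s) (hloc : ∀ i, loc i < d) (h : s.AgreeBelow d s') : Stores loc x s' :=
  ⟨fun i => (h.reg_eq _ (hloc i)).trans (hs.reg_eq i), by rw [h.arr_eq, hs.arr_eq]⟩

/-- The assignment of registers to variables that keeps the additional variable in `r`. -/
def pushVar (loc : Var α → ℕ) (r : ℕ) : Var (α × ℕ) → ℕ :=
  fun i => i.elim r loc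

theorem pushVar_lt {loc : Var α → ℕ} {r d : ℕ} (hloc : ∀ i, loc i < d) (hr : r < d) :
    ∀ i, pushVar loc r i < d := by
  rintro (_ | i)
  exacts [hr, hloc i]

theorem Stores.push {loc : Var α → ℕ} {x : α} {s : State} (hs : Stores loc x s) {r v : ℕ}
    (hr : s.reg r = v) : Stores (pushVar loc r) (x, v) s where
  reg_eq := by
    rintro (_ | i)
    exacts [hr, hs.reg_eq i]
  arr_eq := hs.arr_eq

/-- `f` is bounded by a polynomial in the bound of the environment. -/
def PolyBounded (f : α → ℕ) : Prop :=
  ∃ c, ∀ x, f x ≤ bound x ^ c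

namespace PolyBounded

variable {f g : α → ℕ}

theorem mono (hg : PolyBounded g) (h : ∀ x, f x ≤ g x) : PolyBounded f :=
  let ⟨c, hc⟩ := hg
  ⟨c, fun x => (h x).trans (hc x)⟩

theorem const (v : ℕ) : PolyBounded fun _ : α => v :=
  ⟨v, fun x => Nat.lt_two_pow_self.le.trans (Nat.pow_le_pow_left (two_le_bound x) v)⟩

theorem mul (hf : PolyBounded f) (hg : PolyBounded g) : PolyBounded fun x => f x * g x := by
  obtain ⟨a, ha⟩ := hf
  obtain ⟨b, hb⟩ := hg
  exact ⟨a + b, fun x => (Nat.mul_le_mul (ha x) (hb x)).trans_eq (pow_add _ _ _).symm⟩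

theorem add (hf : PolyBounded f) (hg : PolyBounded g) : PolyBounded fun x => f x + g x := by
  obtain ⟨a, ha⟩ := hf
  obtain ⟨b, hb⟩ := hg
  refine ⟨max a b + 1, fun x => ?_⟩
  have hbound := two_le_bound x
  calc f x + g x ≤ bound x ^ max a b + bound x ^ max a b :=
        add_le_add ((ha x).trans (Nat.pow_le_pow_right (by omega) (le_max_left a b)))
          ((hb x).trans (Nat.pow_le_pow_right (by omega) (le_max_right a b)))
    _ = bound x ^ max a b * 2 := (mul_two _).symm
    _ ≤ bound x ^ (max a b + 1) := Nat.mul_le_mul_left _ hbound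

theorem pow_const (hf : PolyBounded f) (e : ℕ) : PolyBounded fun x => f x ^ e := by
  obtain ⟨a, ha⟩ := hf
  exact ⟨a * e, fun x => (Nat.pow_le_pow_left (ha x) e).trans_eq (pow_mul _ _ _).symm⟩

theorem bound : PolyBounded (bound : α → ℕ) :=
  ⟨1, fun _ => (pow_one _).ge⟩

end PolyBounded

/-- When `x` is stored in the registers `loc`, the program `p` computes `f x` into the register `d`
in time `T x`, and changes neither the registers below `d` nor the arrays. -/
def Computes (p : Program) (loc : Var α → ℕ) (d : ℕ) (f T : α → ℕ) : Prop :=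
  ∀ x s, Stores loc x s → ∃ s', RunsWithin p s s' (T x) ∧ s.AgreeBelow d s' ∧ s'.reg d = f x

theorem Computes.pair {p q : Program} {loc : Var α → ℕ} {d : ℕ} {f g T U : α → ℕ}
    (hp : Computes p loc d f T) (hq : Computes q loc (d + 1) g U) (hloc : ∀ i, loc i < d)
    {x : α} {s : State} (hs : Stores loc x s) :
    ∃ s', RunsWithin (.seq p q) s s' (T x + U x) ∧ s.AgreeBelow d s' ∧ s'.reg d = f x ∧
      s'.reg (d + 1) = g x := by
  obtain ⟨s₁, run₁, agree₁, hf⟩ := hp x s hs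
  obtain ⟨s₂, run₂, agree₂, hg⟩ := hq x s₁ (hs.of_agreeBelow hloc agree₁)
  exact ⟨s₂, run₁.seq run₂, agree₁.trans (agree₂.mono d.le_succ),
    (agree₂.reg_eq d d.lt_succ_self).trans hf, hg⟩

/-- The values of `f` are polynomially bounded, and `f` is computable in polynomially bounded time
wherever its arguments are stored. -/
structure PolyTime (f : α → ℕ) : Prop where
  polyBounded : PolyBounded f
  exists_program : ∃ T : α → ℕ, PolyBounded T ∧
    ∀ loc d, (∀ i, loc i < d) → ∃ p, Computes p loc d f T

open Classical in
/-- The predicate `P` is decidable in polynomially bounded time. -/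
def PolyTimePred (P : α → Prop) : Prop :=
  PolyTime fun x => if P x then 1 else 0

namespace PolyTime

variable {f g u v : α → ℕ}

theorem of_eq (hf : PolyTime f) (h : ∀ x, f x = g x) : PolyTime g :=
  (funext h : f = g) ▸ hf

theorem const (v : ℕ) : PolyTime fun _ : α => v where
  polyBounded := .const v
  exists_program := ⟨_, .const 1, fun _ d _ => ⟨.const d v, fun _ s _ =>
    ⟨_, (Runs.const s d v).runsWithin, (State.AgreeBelow.refl d s).setReg le_rfl v, by simp⟩⟩⟩

theorem value (i : Var α) (hb : PolyBounded fun x : α => value x i) :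
    PolyTime fun x : α => value x i where
  polyBounded := hb
  exists_program := ⟨_, .const 1, fun loc d _ => ⟨.copy d (loc i), fun x s hs =>
    ⟨_, (Runs.copy s d (loc i)).runsWithin, (State.AgreeBelow.refl d s).setReg le_rfl _,
      by simp [hs.reg_eq]⟩⟩⟩

theorem snd : PolyTime fun x : α × ℕ => x.2 :=
  value (α := α × ℕ) none ⟨1, fun _ => (le_max_right _ _).trans (pow_one _).ge⟩

theorem rename (hf : PolyTime f) (φ : β → α) (e : Var α → Var β)
    (hvalue : ∀ y i, Environment.value (φ y) i = Environment.value y (e i))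
    (hcells : ∀ y, cells (φ y) = cells y) (hbound : ∀ y, bound (φ y) ≤ bound y) :
    PolyTime fun y => f (φ y) := by
  have pull {T : α → ℕ} : PolyBounded T → PolyBounded fun y => T (φ y) := fun ⟨c, hc⟩ =>
    ⟨c, fun y => (hc (φ y)).trans (Nat.pow_le_pow_left (hbound y) c)⟩
  obtain ⟨T, hT, hp⟩ := hf.exists_program
  refine ⟨pull hf.polyBounded, _, pull hT, fun loc d hloc => ?_⟩
  obtain ⟨p, hp⟩ := hp (loc ∘ e) d fun i => hloc (e i)
  exact ⟨p, fun y s hs => hp (φ y) s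
    ⟨fun i => (hs.reg_eq (e i)).trans (hvalue y i).symm, hs.arr_eq.trans (hcells y).symm⟩⟩

theorem comp_fst (hf : PolyTime f) : PolyTime fun x : α × ℕ => f x.1 :=
  hf.rename Prod.fst some (fun _ _ => rfl) (fun _ => rfl) fun _ => le_max_left _ _

theorem comp_fst_fst_snd {f : α × ℕ → ℕ} (hf : PolyTime f) :
    PolyTime fun x : (α × ℕ) × ℕ => f (x.1.1, x.2) :=
  hf.rename (fun x : (α × ℕ) × ℕ => (x.1.1, x.2)) (Option.map some) (by rintro _ (_ | _) <;> rfl)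
    (fun _ => rfl) fun _ => max_le_max_right _ (le_max_left _ _)

theorem binary {F : ℕ → ℕ → ℕ} {op : ℕ → Program}
    (hop : ∀ d s, Runs (op d) s (s.setReg d (F (s.reg d) (s.reg (d + 1)))) 1)
    (hf : PolyTime f) (hg : PolyTime g) (hb : PolyBounded fun x => F (f x) (g x)) :
    PolyTime fun x => F (f x) (g x) := by
  obtain ⟨Tf, hTf, hf⟩ := hf.exists_program
  obtain ⟨Tg, hTg, hg⟩ := hg.exists_program
  refine ⟨hb, _, (hTf.add hTg).add (.const 1), fun loc d hloc => ?_⟩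
  obtain ⟨p, hp⟩ := hf loc d hloc
  obtain ⟨q, hq⟩ := hg loc (d + 1) fun i => (hloc i).trans d.lt_succ_self
  refine ⟨.seq (.seq p q) (op d), fun x s hs => ?_⟩
  obtain ⟨s', run, agree, hd, hd'⟩ := hp.pair hq hloc hs
  exact ⟨_, run.seq (hop d s').runsWithin, agree.setReg le_rfl _, by simp [hd, hd']⟩

theorem add (hf : PolyTime f) (hg : PolyTime g) : PolyTime fun x => f x + g x :=
  binary (fun d s => .add s d d (d + 1)) hf hg (hf.polyBounded.add hg.polyBounded)

theorem sub (hf : PolyTime f) (hg : PolyTime g) : PolyTime fun x => f x - g x :=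
  binary (fun d s => .sub s d d (d + 1)) hf hg (hf.polyBounded.mono fun _ => Nat.sub_le _ _)

theorem load (hf : PolyTime f) (hb : PolyBounded fun x => cells x (f x)) :
    PolyTime fun x => cells x (f x) := by
  obtain ⟨T, hT, hf⟩ := hf.exists_program
  refine ⟨hb, _, hT.add (.const 1), fun loc d hloc => ?_⟩
  obtain ⟨p, hp⟩ := hf loc d hloc
  refine ⟨.seq p (.load d 0 d), fun x s hs => ?_⟩
  obtain ⟨s', run, agree, hd⟩ := hp x s hs
  exact ⟨_, run.seq (Runs.load s' d 0 d).runsWithin, agree.setReg le_rfl _,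
    by simp [hd, agree.arr_eq, hs.arr_eq]⟩

theorem ite_lt (hf : PolyTime f) (hg : PolyTime g) (hu : PolyTime u) (hv : PolyTime v) :
    PolyTime fun x => if f x < g x then u x else v x := by
  have hb : PolyBounded fun x => if f x < g x then u x else v x :=
    (hu.polyBounded.add hv.polyBounded).mono fun x => by split <;> omega
  obtain ⟨Tf, hTf, hf⟩ := hf.exists_program
  obtain ⟨Tg, hTg, hg⟩ := hg.exists_program
  obtain ⟨Tu, hTu, hu⟩ := hu.exists_program
  obtain ⟨Tv, hTv, hv⟩ := hv.exists_program
  refine ⟨hb, fun x => Tf x + Tg x + (Tu x + Tv x + 1),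
    (hTf.add hTg).add ((hTu.add hTv).add (.const 1)), fun loc d hloc => ?_⟩
  obtain ⟨p, hp⟩ := hf loc d hloc
  obtain ⟨q, hq⟩ := hg loc (d + 1) fun i => (hloc i).trans d.lt_succ_self
  obtain ⟨pu, hpu⟩ := hu loc d hloc
  obtain ⟨pv, hpv⟩ := hv loc d hloc
  refine ⟨.seq (.seq p q) (.ifLt d (d + 1) pu pv), fun x s hs => ?_⟩
  obtain ⟨s₁, run₁, agree₁, hd, hd'⟩ := hp.pair hq hloc hs
  simp only [← hd, ← hd']
  split_ifs with hlt
  · obtain ⟨s₂, run₂, agree₂, hu⟩ := hpu x s₁ (hs.of_agreeBelow hloc agree₁)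
    exact ⟨s₂, run₁.seq ((run₂.mono (Nat.le_add_right _ _)).ifTrue hlt), agree₁.trans agree₂, hu⟩
  · obtain ⟨s₂, run₂, agree₂, hv⟩ := hpv x s₁ (hs.of_agreeBelow hloc agree₁)
    exact ⟨s₂, run₁.seq ((run₂.mono (Nat.le_add_left _ _)).ifFalse hlt), agree₁.trans agree₂, hv⟩

end PolyTime

/-- The state `s` during a primitive recursion in the workspace from `d` on: `acc` has been
obtained after `i` of `m` iterations. -/
structure RecursionState (d acc m i : ℕ) (s : State) : Prop where
  acc_eq : s.reg d = acc
  limit_eq : s.reg (d + 1) = m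
  counter_eq : s.reg (d + 2) = i
  one_eq : s.reg (d + 3) = 1

/-- One iteration of a primitive recursion whose step is computed by `p` into `d + 4`. -/
def recursionBody (p : Program) (d : ℕ) : Program :=
  .seq p (.seq (.copy d (d + 4)) (.add (d + 2) (d + 2) (d + 3)))

theorem recursionBody_runsWithin {p : Program} {loc : Var α → ℕ} {d : ℕ} {b T : (α × ℕ) × ℕ → ℕ}
    (hp : Computes p (pushVar (pushVar loc (d + 2)) d) (d + 4) b T) {x : α} {s : State}
    {acc m i : ℕ} (hs : Stores loc x s) (hrec : RecursionState d acc m i s) :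
    ∃ s', RunsWithin (recursionBody p d) s s' (T ((x, i), acc) + 2) ∧ s.AgreeBelow d s' ∧
      RecursionState d (b ((x, i), acc)) m (i + 1) s' := by
  obtain ⟨s₁, run₁, agree₁, hb⟩ :=
    hp ((x, i), acc) s ((hs.push hrec.counter_eq).push hrec.acc_eq)
  refine ⟨_, run₁.seq ((Runs.copy s₁ d (d + 4)).runsWithin.seq
    (Runs.add _ (d + 2) (d + 2) (d + 3)).runsWithin),
    ((agree₁.mono (by omega)).setReg le_rfl _).setReg (by omega) _, ?_⟩
  have hlimit := (agree₁.reg_eq (d + 1) (by omega)).trans hrec.limit_eq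
  have hcounter := (agree₁.reg_eq (d + 2) (by omega)).trans hrec.counter_eq
  have hone := (agree₁.reg_eq (d + 3) (by omega)).trans hrec.one_eq
  constructor <;> simp [*]

theorem recursionLoop_runsWithin {p : Program} {loc : Var α → ℕ} {d : ℕ} {x : α} {m S : ℕ}
    {b : α → ℕ → ℕ → ℕ} {F : ℕ → ℕ} {T : (α × ℕ) × ℕ → ℕ} (hloc : ∀ i, loc i < d)
    (hp : Computes p (pushVar (pushVar loc (d + 2)) d) (d + 4) (fun y => b y.1.1 y.1.2 y.2) T)
    (hT : ∀ i < m, T ((x, i), F i) ≤ S) (hF : ∀ i < m, F (i + 1) = b x i (F i))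
    {s : State} (hs : Stores loc x s) (hrec : RecursionState d (F 0) m 0 s) :
    ∃ s', RunsWithin (.whileLt (d + 2) (d + 1) (recursionBody p d)) s s' (m * (S + 3) + 1) ∧
      s.AgreeBelow d s' ∧ s'.reg d = F m := by
  obtain ⟨s', run, agree, hrec'⟩ := RunsWithin.whileLt_of_invariant (p := recursionBody p d)
    (x := d + 2) (y := d + 1) (m := m) (T := S + 2)
    (fun i s' => s.AgreeBelow d s' ∧ RecursionState d (F i) m i s')
    (fun i hi s₁ ⟨agree₁, hrec₁⟩ => by
      obtain ⟨s₂, run₂, agree₂, hrec₂⟩ :=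
        recursionBody_runsWithin hp (hs.of_agreeBelow hloc agree₁) hrec₁
      exact ⟨by rwa [hrec₁.counter_eq, hrec₁.limit_eq], s₂,
        run₂.mono (Nat.add_le_add_right (hT i hi) 2), agree₁.trans agree₂, hF i hi ▸ hrec₂⟩)
    (fun s₁ ⟨_, hrec₁⟩ => by rw [hrec₁.counter_eq, hrec₁.limit_eq]; exact lt_irrefl m)
    ⟨.refl d s, hrec⟩
  exact ⟨s', run, agree, hrec'.acc_eq⟩

namespace PolyTime

theorem recursion {m A : α → ℕ} {F : α → ℕ → ℕ} (b : α → ℕ → ℕ → ℕ) (hm : PolyTime m)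
    (h0 : PolyTime fun x => F x 0) (hb : PolyTime fun y : (α × ℕ) × ℕ => b y.1.1 y.1.2 y.2)
    (hA : PolyBounded A) (hFA : ∀ x, ∀ i ≤ m x, F x i ≤ A x)
    (hF : ∀ x, ∀ i < m x, F x (i + 1) = b x i (F x i)) : PolyTime fun x => F x (m x) := by
  obtain ⟨T₀, hT₀, h0⟩ := h0.exists_program
  obtain ⟨Tm, hTm, hm'⟩ := hm.exists_program
  obtain ⟨T, ⟨e, hT⟩, hb⟩ := hb.exists_program
  let S : α → ℕ := fun x => (bound x + m x + A x) ^ e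
  have hS : PolyBounded S := ((PolyBounded.bound.add hm.polyBounded).add hA).pow_const e
  have hTS (x : α) (i : ℕ) (hi : i < m x) : T ((x, i), F x i) ≤ S x :=
    (hT _).trans <| Nat.pow_le_pow_left (by
      have := hFA x i hi.le
      change max (max (bound x) i) (F x i) ≤ _
      omega) e
  refine ⟨hA.mono fun x => hFA x _ le_rfl,
    fun x => T₀ x + Tm x + (1 + (1 + (m x * (S x + 3) + 1))), (hT₀.add hTm).add <|
      (PolyBounded.const 1).add <| (PolyBounded.const 1).add <|
        (hm.polyBounded.mul (hS.add (.const 3))).add (.const 1), fun loc d hloc => ?_⟩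
  obtain ⟨p₀, hp₀⟩ := h0 loc d hloc
  obtain ⟨pm, hpm⟩ := hm' loc (d + 1) fun i => (hloc i).trans d.lt_succ_self
  obtain ⟨p, hp⟩ := hb (pushVar (pushVar loc (d + 2)) d) (d + 4)
    (pushVar_lt (pushVar_lt (fun i => (hloc i).trans (by omega)) (by omega)) (by omega))
  refine ⟨.seq (.seq p₀ pm) (.seq (.const (d + 2) 0) (.seq (.const (d + 3) 1)
    (.whileLt (d + 2) (d + 1) (recursionBody p d)))), fun x s hs => ?_⟩
  obtain ⟨s₁, run₁, agree₁, hacc, hlimit⟩ := hp₀.pair hpm hloc hs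
  have agree₂ := (agree₁.setReg (r := d + 2) (by omega) 0).setReg (r := d + 3) (by omega) 1
  obtain ⟨s₂, run₂, agree₃, hd⟩ := recursionLoop_runsWithin hloc hp (hTS x) (hF x)
    (hs.of_agreeBelow hloc agree₂) (by constructor <;> simp [hacc, hlimit])
  exact ⟨s₂, run₁.seq ((Runs.const s₁ (d + 2) 0).runsWithin.seq
    ((Runs.const _ (d + 3) 1).runsWithin.seq run₂)), agree₂.trans agree₃, hd⟩

end PolyTime

namespace PolyTime

variable {f g h : α → ℕ}

theorem mul (hf : PolyTime f) (hg : PolyTime g) : PolyTime fun x => f x * g x :=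
  recursion (F := fun x i => i * g x) (fun x _ acc => acc + g x) hf
    ((const 0).of_eq fun _ => (Nat.zero_mul _).symm) (snd.add hg.comp_fst.comp_fst)
    (hf.polyBounded.mul hg.polyBounded) (fun _ _ hi => Nat.mul_le_mul_right _ hi)
    fun _ _ _ => Nat.succ_mul _ _

theorem pow (hf : PolyTime f) (hg : PolyTime g) (hb : PolyBounded fun x => f x ^ g x) :
    PolyTime fun x => f x ^ g x := by
  refine recursion (F := fun x i => f x ^ i) (fun x _ acc => acc * f x) hg
    ((const 1).of_eq fun _ => (pow_zero _).symm) (snd.mul hf.comp_fst.comp_fst)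
    (hb.add (.const 1)) (fun x i hi => ?_) fun _ _ _ => pow_succ _ _
  rcases Nat.eq_zero_or_pos (f x) with h0 | hpos
  · exact (pow_le_one₀ (Nat.zero_le _) (h0.trans_le zero_le_one)).trans (Nat.le_add_left _ _)
  · exact (Nat.pow_le_pow_right hpos hi).trans (Nat.le_succ _)

theorem count {P : α → ℕ → Prop} [∀ x, DecidablePred (P x)]
    (hP : PolyTimePred fun y : α × ℕ => P y.1 y.2) (hf : PolyTime f) :
    PolyTime fun x => Nat.count (P x) (f x) := by
  classical
  have hP : PolyTime fun y : α × ℕ => if P y.1 y.2 then 1 else 0 := hP.of_eq fun _ => by congr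
  exact recursion (F := fun x => Nat.count (P x)) (fun x i acc => acc + if P x i then 1 else 0) hf
    ((const 0).of_eq fun _ => (Nat.count_zero _).symm) (snd.add hP.comp_fst) hf.polyBounded
    (fun _ _ hi => (Nat.count_le _).trans hi) fun _ _ _ => Nat.count_succ _ _

end PolyTime

namespace PolyTimePred

variable {P Q : α → Prop} {f g : α → ℕ}

theorem of_iff (hP : PolyTimePred P) (h : ∀ x, P x ↔ Q x) : PolyTimePred Q :=
  (funext fun x => propext (h x) : P = Q) ▸ hP

theorem comp_fst_fst_snd {P : α × ℕ → Prop} (hP : PolyTimePred P) :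
    PolyTimePred fun x : (α × ℕ) × ℕ => P (x.1.1, x.2) :=
  PolyTime.comp_fst_fst_snd hP

theorem not (hP : PolyTimePred P) : PolyTimePred fun x => ¬ P x :=
  (PolyTime.sub (.const 1) hP).of_eq fun x => by by_cases h : P x <;> simp [h]

theorem and (hP : PolyTimePred P) (hQ : PolyTimePred Q) : PolyTimePred fun x => P x ∧ Q x :=
  (PolyTime.mul hP hQ).of_eq fun x => by by_cases h : P x <;> by_cases h' : Q x <;> simp [h, h']

theorem or (hP : PolyTimePred P) (hQ : PolyTimePred Q) : PolyTimePred fun x => P x ∨ Q x :=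
  (hP.not.and hQ.not).not.of_iff fun _ => or_iff_not_and_not.symm

theorem imp (hP : PolyTimePred P) (hQ : PolyTimePred Q) : PolyTimePred fun x => P x → Q x :=
  (hP.not.or hQ).of_iff fun _ => imp_iff_not_or.symm

theorem lt (hf : PolyTime f) (hg : PolyTime g) : PolyTimePred fun x => f x < g x :=
  (hf.ite_lt hg (.const 1) (.const 0)).of_eq fun _ => by congr

theorem le (hf : PolyTime f) (hg : PolyTime g) : PolyTimePred fun x => f x ≤ g x :=
  (lt hg hf).not.of_iff fun _ => not_lt

theorem eq (hf : PolyTime f) (hg : PolyTime g) : PolyTimePred fun x => f x = g x :=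
  ((le hf hg).and (le hg hf)).of_iff fun _ => le_antisymm_iff.symm

theorem ne (hf : PolyTime f) (hg : PolyTime g) : PolyTimePred fun x => f x ≠ g x :=
  (eq hf hg).not

theorem exists_lt {P : α → ℕ → Prop} (hP : PolyTimePred fun y : α × ℕ => P y.1 y.2)
    (hf : PolyTime f) : PolyTimePred fun x => ∃ i < f x, P x i := by
  classical
  exact (ne (.count hP hf) (.const 0)).of_iff fun _ => Nat.count_ne_iff_exists

theorem forall_lt {P : α → ℕ → Prop} (hP : PolyTimePred fun y : α × ℕ => P y.1 y.2)
    (hf : PolyTime f) : PolyTimePred fun x => ∀ i < f x, P x i :=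
  (hP.not.exists_lt (P := fun x i => ¬ P x i) hf).not.of_iff fun _ => by push Not; rfl

end PolyTimePred

namespace PolyTime

variable {f g h : α → ℕ}

theorem of_hypograph (hg : PolyTime g) (hfg : ∀ x, f x ≤ g x)
    (hf : PolyTimePred fun y : α × ℕ => y.2 < f y.1) : PolyTime f :=
  (count hf (P := fun x i => i < f x) hg).of_eq fun x => by
    have : {i ∈ Finset.range (g x) | i < f x} = Finset.range (f x) := by
      ext i
      have := hfg x
      simp only [Finset.mem_filter, Finset.mem_range]
      omega
    rw [Nat.count_eq_card_filter_range, this, Finset.card_range]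

theorem div (hf : PolyTime f) (hg : PolyTime g) : PolyTime fun x => f x / g x := by
  have hlt : PolyTimePred fun y : α × ℕ => 0 < g y.1 ∧ (y.2 + 1) * g y.1 ≤ f y.1 :=
    .and (.lt (const 0) hg.comp_fst) (.le ((snd.add (const 1)).mul hg.comp_fst) hf.comp_fst)
  refine of_hypograph hf (fun _ => Nat.div_le_self _ _) (hlt.of_iff fun y => ?_)
  rcases Nat.eq_zero_or_pos (g y.1) with h0 | hpos
  · simp [h0]
  · rw [and_iff_right hpos, ← Nat.le_div_iff_mul_le hpos, Nat.succ_le_iff]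

theorem mod (hf : PolyTime f) (hg : PolyTime g) : PolyTime fun x => f x % g x :=
  (hf.sub (hg.mul (hf.div hg))).of_eq fun _ => (Nat.mod_eq_sub _ _).symm

theorem div_pow (hf : PolyTime f) (hg : PolyTime g) (hh : PolyTime h) :
    PolyTime fun x => f x / g x ^ h x :=
  recursion (F := fun x i => f x / g x ^ i) (fun x _ acc => acc / g x) hh
    (hf.of_eq fun _ => by rw [pow_zero, Nat.div_one]) (snd.div hg.comp_fst.comp_fst) hf.polyBounded
    (fun _ _ _ => Nat.div_le_self _ _) fun _ _ _ => by rw [pow_succ, Nat.div_div_eq_div_mul]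

theorem nth {P : α → ℕ → Prop} (hP : PolyTimePred fun y : α × ℕ => P y.1 y.2)
    (hf : PolyTime f) (hPf : ∀ x v, P x v → v < f x) (hg : PolyTime g) :
    PolyTime fun x => Nat.nth (P x) (g x) := by
  classical
  have hcount : PolyTime fun y : α × ℕ => Nat.count (P y.1) y.2 :=
    count (P := fun y : α × ℕ => P y.1) hP.comp_fst_fst_snd snd
  have hnth (x : α) (i : ℕ) :
      (∃ v < f x, P x v ∧ Nat.count (P x) v = g x ∧ i < v) ↔ i < Nat.nth (P x) (g x) := by
    refine ⟨fun ⟨v, _, hv, hcount, hi⟩ => by rwa [← hcount, Nat.nth_count hv], fun hi => ?_⟩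
    have hcard (hfin : (Set.ofPred (P x)).Finite) : g x < hfin.toFinset.card :=
      lt_of_not_ge fun hcard => by simp [Nat.nth_of_card_le hfin hcard] at hi
    have hmem := Nat.nth_mem (g x) hcard
    exact ⟨_, hPf x _ hmem, hmem, Nat.count_nth hcard, hi⟩
  refine of_hypograph hf (fun x => not_lt.1 fun hlt => ?_)
    ((PolyTimePred.exists_lt (P := fun y v => P y.1 v ∧ Nat.count (P y.1) v = g y.1 ∧ y.2 < v)
      (.and hP.comp_fst_fst_snd
        (.and (.eq hcount.comp_fst_fst_snd hg.comp_fst.comp_fst) (.lt snd.comp_fst snd)))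
      hf.comp_fst).of_iff fun y => hnth y.1 y.2)
  obtain ⟨v, hv, -, -, hlt⟩ := (hnth x (f x)).2 hlt
  exact hv.not_gt hlt

end PolyTime
end RAM

section GraphColoring

variable {V κ ι : Type*}

/-- `Col v j` ("the vertex `v` has the color `j`") is a proper coloring of a part of `G`. It is
given as a relation, so that it can be assembled from several pieces. -/
structure IsPartialColoring (G : SimpleGraph V) (Col : V → κ → Prop) : Prop where
  unique : ∀ v i j, Col v i → Col v j → i = j
  proper : ∀ u v i, G.Adj u v → Col u i → ¬ Col v i

namespace IsPartialColoring

variable {G : SimpleGraph V} {Col : V → κ → Prop}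

theorem exists_free_color [Fintype κ] (hCol : IsPartialColoring G Col) {v : V}
    [Fintype (G.neighborSet v)] (hv : G.degree v < Fintype.card κ) :
    ∃ j, ∀ u, G.Adj v u → ¬ Col u j := by
  by_contra! hused
  choose f hadj hf using hused
  have hinj : Function.Injective f := fun i j hij => hCol.unique (f i) i j (hf i) (hij ▸ hf j)
  have := Finset.card_le_card_of_injOn (s := Finset.univ) (t := G.neighborFinset v) f
    (fun j _ => by simpa using hadj j) hinj.injOn
  rw [Finset.card_univ, G.card_neighborFinset_eq_degree] at this
  exact hv.not_ge this

theorem insert (hCol : IsPartialColoring G Col) {v : V} {j : κ} (hv : ∀ i, ¬ Col v i)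
    (hj : ∀ u, G.Adj v u → ¬ Col u j) :
    IsPartialColoring G fun u i => Col u i ∨ u = v ∧ i = j where
  unique := by
    rintro u a b (ha | ⟨hu, ha⟩) (hb | ⟨hu', hb⟩)
    exacts [hCol.unique u a b ha hb, (hv a (hu' ▸ ha)).elim, (hv b (hu ▸ hb)).elim,
      ha.trans hb.symm]
  proper := by
    rintro u w a huw (hu | ⟨rfl, rfl⟩) (hw | ⟨rfl, hw⟩)
    exacts [hCol.proper u w a huw hu hw, hj u huw.symm (hw ▸ hu), hj w huw hw, G.irrefl huw]

theorem exists_extension [Fintype κ] (hCol : IsPartialColoring G Col) {v : V}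
    [Fintype (G.neighborSet v)] (hv : (∃ j, Col v j) ∨ G.degree v < Fintype.card κ) :
    ∃ Col' : V → κ → Prop, IsPartialColoring G Col' ∧ (∀ u i, Col u i → Col' u i) ∧
      ∃ j, Col' v j := by
  by_cases hcolored : ∃ j, Col v j
  · exact ⟨Col, hCol, fun _ _ => id, hcolored⟩
  · obtain ⟨j, hj⟩ := hCol.exists_free_color (hv.resolve_left hcolored)
    exact ⟨_, hCol.insert (not_exists.1 hcolored) hj, fun _ _ => .inl, j, .inr ⟨rfl, rfl⟩⟩

theorem exists_coloring [Fintype κ] [Fintype V] [DecidableRel G.Adj]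
    (hCol : IsPartialColoring G Col)
    (hdeg : ∀ v, (∃ j, Col v j) ∨ G.degree v < Fintype.card κ) :
    ∃ C : G.Coloring κ, ∀ v j, Col v j → C v = j := by
  have greedy (s : Finset V) : ∃ Col' : V → κ → Prop, IsPartialColoring G Col' ∧
      (∀ u i, Col u i → Col' u i) ∧ ∀ v ∈ s, ∃ j, Col' v j := by
    classical
    induction s using Finset.induction with
    | empty => exact ⟨Col, hCol, fun _ _ => id, by simp⟩
    | insert v s _ ih =>
      obtain ⟨Col₁, hCol₁, hle₁, hs⟩ := ih
      obtain ⟨Col₂, hCol₂, hle₂, hv⟩ :=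
        hCol₁.exists_extension ((hdeg v).imp_left fun ⟨j, hj⟩ => ⟨j, hle₁ v j hj⟩)
      refine ⟨Col₂, hCol₂, fun u i hu => hle₂ u i (hle₁ u i hu), fun u hu => ?_⟩
      rcases Finset.mem_insert.1 hu with rfl | hu
      · exact hv
      · exact (hs u hu).imp fun _ => hle₂ u _
  obtain ⟨Col', hCol', hle, htotal⟩ := greedy Finset.univ
  choose C hC using fun v => htotal v (Finset.mem_univ v)
  exact ⟨.mk C fun {u v} huv heq => hCol'.proper u v (C u) huv (hC u) (heq ▸ hC v),
    fun v j hj => hCol'.unique v _ _ (hC v) (hle v j hj)⟩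

theorem of_scattered (C : G.Coloring κ) {H : Set V} {x : ι → V} {e : ι → V → κ}
    (he : ∀ i, Set.InjOn (e i) {u | G.edist u (x i) ≤ 1})
    (hH : ∀ i, ∀ h ∈ H, 2 < G.edist (x i) h)
    (hx : Pairwise fun i j => 3 < G.edist (x i) (x j)) :
    IsPartialColoring G fun v j => (v ∈ H ∧ C v = j) ∨ ∃ i, G.edist v (x i) ≤ 1 ∧ e i v = j := by
  have far_from_H {i : ι} {u v : V} (hu : u ∈ H) (hv : G.edist v (x i) ≤ 1) :
      ¬ G.edist v u ≤ 1 := fun huv => (hH i u hu).not_ge <|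
    calc G.edist (x i) u ≤ G.edist (x i) v + G.edist v u := G.edist_triangle
      _ ≤ 1 + 1 := add_le_add (G.edist_comm.trans_le hv) huv
      _ = 2 := one_add_one_eq_two
  have same_center {i j : ι} {u v : V} (hu : G.edist u (x i) ≤ 1) (hv : G.edist v (x j) ≤ 1)
      (huv : G.edist u v ≤ 1) : i = j := hx.eq fun hij => hij.not_ge <|
    calc G.edist (x i) (x j) ≤ G.edist (x i) u + (G.edist u v + G.edist v (x j)) :=
        G.edist_triangle.trans (by gcongr; exact G.edist_triangle)
      _ ≤ 1 + (1 + 1) := add_le_add (G.edist_comm.trans_le hu) (add_le_add huv hv)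
      _ = 3 := by norm_num
  have edist_self_le (v : V) : G.edist v v ≤ 1 := by simp
  have edist_le {u v : V} (huv : G.Adj u v) : G.edist u v ≤ 1 :=
    G.edist_le_one_iff_adj_or_eq.2 (.inl huv)
  constructor
  · rintro v a b (⟨hv, rfl⟩ | ⟨i, hi, rfl⟩) (⟨hv', rfl⟩ | ⟨j, hj, rfl⟩)
    · rfl
    · exact (far_from_H hv hj (edist_self_le v)).elim
    · exact (far_from_H hv' hi (edist_self_le v)).elim
    · rw [same_center hi hj (edist_self_le v)]
  · rintro u v a huv (⟨hu, rfl⟩ | ⟨i, hi, rfl⟩) (⟨hv, heq⟩ | ⟨j, hj, heq⟩)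
    · exact C.valid huv heq.symm
    · exact far_from_H hu hj (edist_le huv.symm)
    · exact far_from_H hv hi (edist_le huv)
    · obtain rfl := same_center hi hj (edist_le huv)
      exact G.ne_of_adj huv (he i hi hj heq.symm)

end IsPartialColoring

theorem exists_edist_le_of_edist_le_succ (G : SimpleGraph V) {u v : V} {r : ℕ}
    (h : G.edist u v ≤ (r + 1 : ℕ)) : ∃ w, G.edist w v ≤ r ∧ (w = u ∨ G.Adj w u) := by
  obtain ⟨p, hp⟩ := G.exists_walk_of_edist_ne_top (ne_top_of_le_ne_top (ENat.natCast_ne_top _) h)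
  rw [← hp, Nat.cast_le] at h
  cases p with
  | nil => exact ⟨u, by simp, .inl rfl⟩
  | @cons _ w _ huw q =>
    rw [SimpleGraph.Walk.length_cons, Nat.succ_le_succ_iff] at h
    exact ⟨w, (G.edist_le q).trans (Nat.cast_le.2 h), .inr huw.symm⟩

open Classical in
theorem card_filter_edist_le [Fintype V] (G : SimpleGraph V) (v : V) (r : ℕ) :
    (Finset.univ.filter fun u => G.edist u v ≤ r).card ≤ (G.maxDegree + 1) ^ r := by
  induction r with
  | zero => exact Finset.card_le_one.2 (by simp)
  | succ r ih =>
    have hsub : (Finset.univ.filter fun u => G.edist u v ≤ (r + 1 : ℕ)) ⊆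
        (Finset.univ.filter fun w => G.edist w v ≤ r).biUnion
          fun w => insert w (G.neighborFinset w) := fun u hu => by
      obtain ⟨w, hw, hwu⟩ := exists_edist_le_of_edist_le_succ G (Finset.mem_filter.1 hu).2
      simpa [eq_comm (a := u)] using ⟨w, hw, hwu⟩
    have hcard (w : V) : (insert w (G.neighborFinset w)).card ≤ G.maxDegree + 1 :=
      (Finset.card_insert_le _ _).trans (by simpa using G.degree_le_maxDegree w)
    calc (Finset.univ.filter fun u => G.edist u v ≤ (r + 1 : ℕ)).card
        ≤ (Finset.univ.filter fun w => G.edist w v ≤ r).card * (G.maxDegree + 1) :=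
          (Finset.card_le_card hsub).trans
            (Finset.card_biUnion_le_card_mul _ _ _ fun w _ => hcard w)
      _ ≤ (G.maxDegree + 1) ^ r * (G.maxDegree + 1) := Nat.mul_le_mul_right _ ih
      _ = (G.maxDegree + 1) ^ (r + 1) := (pow_succ _ _).symm

theorem exists_scattered {N : V → Finset V} {d : ℕ} (hd : 0 < d) (hN : ∀ v, (N v).card ≤ d)
    (hsymm : ∀ u v, u ∈ N v → v ∈ N u) (S : Finset V) (k : ℕ) (H : Finset V)
    (hS : (H.card + k) * d ≤ S.card) :
    ∃ x : Fin k → V, (∀ i, x i ∈ S) ∧ (∀ i, ∀ h ∈ H, x i ∉ N h) ∧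
      Pairwise fun i j => x i ∉ N (x j) := by
  classical
  induction k generalizing H with
  | zero => exact ⟨finZeroElim, finZeroElim, finZeroElim, finZeroElim⟩
  | succ k ih =>
    have hlt : (H.biUnion N).card < S.card :=
      (Finset.card_biUnion_le_card_mul H N d fun v _ => hN v).trans_lt
        ((Nat.mul_lt_mul_of_pos_right (by omega) hd).trans_le hS)
    obtain ⟨x, hxS, hxH⟩ := Finset.exists_mem_notMem_of_card_lt_card hlt
    simp only [Finset.mem_biUnion, not_exists, not_and] at hxH
    obtain ⟨y, hyS, hyH, hy⟩ := ih (insert x H) <|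
      (Nat.mul_le_mul_right d (by have := H.card_insert_le x; omega)).trans hS
    refine ⟨Fin.cons x y, Fin.cases hxS hyS,
      Fin.cases hxH fun i h hh => hyH i h (Finset.mem_insert_of_mem hh), fun i j hij => ?_⟩
    cases i using Fin.cases with
    | zero =>
      cases j using Fin.cases with
      | zero => exact absurd rfl hij
      | succ j => exact fun hmem => hyH j x (H.mem_insert_self x) (hsymm _ _ hmem)
    | succ i =>
      cases j using Fin.cases with
      | zero => exact hyH i x (H.mem_insert_self x)
      | succ j => exact hy fun h => hij (congrArg _ h)

theorem exists_rainbow_neighborhood [Fintype κ] (G : SimpleGraph V) {v : V}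
    [Fintype (G.neighborSet v)] (hv : G.degree v + 1 = Fintype.card κ) (i : κ) :
    ∃ e : V → κ, Set.InjOn e {u | G.edist u v ≤ 1} ∧ e v = i ∧
      ∀ j, j ≠ i → ∃ u, G.Adj v u ∧ e u = j := by
  classical
  have hcard : Fintype.card (G.neighborSet v) = Fintype.card {j // j ≠ i} := by
    rw [G.card_neighborSet_eq_degree, Fintype.card_subtype_compl, Fintype.card_subtype_eq]
    omega
  let f := Fintype.equivOfCardEq hcard
  let e (u : V) : κ := if h : G.Adj v u then f ⟨u, h⟩ else i
  have e_adj {u : V} (h : G.Adj v u) : e u = f ⟨u, h⟩ := dif_pos h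
  have e_self : e v = i := dif_neg G.irrefl
  refine ⟨e, ?_, e_self, fun j hj => ⟨f.symm ⟨j, hj⟩, (f.symm ⟨j, hj⟩).2, ?_⟩⟩
  · intro u hu w hw huw
    rw [Set.mem_ofPred_eq, G.edist_le_one_iff_adj_or_eq] at hu hw
    rcases hu with hu | rfl <;> rcases hw with hw | rfl
    · rw [e_adj hu.symm, e_adj hw.symm] at huw
      exact congrArg Subtype.val (f.injective (Subtype.ext huw))
    · exact ((f ⟨u, hu.symm⟩).2 (e_adj hu.symm ▸ huw.trans e_self)).elim
    · exact ((f ⟨w, hw.symm⟩).2 (e_adj hw.symm ▸ huw.symm.trans e_self)).elim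
    · rfl
  · rw [e_adj (f.symm ⟨j, hj⟩).2, Subtype.coe_eta, f.apply_symm_apply]

open Classical in
theorem exists_bColoring_of_many_tight [Fintype V] {G : SimpleGraph V} {k : ℕ}
    (C : G.Coloring (Fin k)) {S : Finset V} (hS : ∀ v ∈ S, G.degree v + 1 = k)
    (hcard : ((Finset.univ.filter fun v => k ≤ G.degree v).card + k) * (G.maxDegree + 1) ^ 3 ≤
      S.card) :
    ∃ C' : G.Coloring (Fin k), ∀ i, ∃ x ∈ S, C' x = i ∧ ∀ j, j ≠ i → ∃ y, G.Adj x y ∧ C' y = j := by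
  obtain ⟨x, hxS, hxH, hx⟩ := exists_scattered (k := k)
    (N := fun v => Finset.univ.filter fun u => G.edist u v ≤ 3) (by positivity)
    (fun v => card_filter_edist_le G v 3) (by simp [G.edist_comm]) S _ hcard
  choose e he hex headj using fun i => exists_rainbow_neighborhood G
    (show G.degree (x i) + 1 = Fintype.card (Fin k) by rw [hS _ (hxS i), Fintype.card_fin]) i
  simp only [Finset.mem_filter, Finset.mem_univ, true_and, not_le] at hxH hx
  obtain ⟨C', hC'⟩ := (IsPartialColoring.of_scattered C (H := {v | k ≤ G.degree v}) he
    (fun i h hh => lt_trans (by norm_num) (hxH i h hh)) hx).exists_coloring fun v => by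
      rw [Fintype.card_fin]
      exact (le_or_gt k (G.degree v)).imp_left fun h => ⟨C v, .inl ⟨h, rfl⟩⟩
  refine ⟨C', fun i => ⟨x i, hxS i, hC' _ _ (.inr ⟨i, by simp, hex i⟩), fun j hj => ?_⟩⟩
  obtain ⟨y, hy, rfl⟩ := headj i j hj
  exact ⟨y, hy, hC' _ _ (.inr ⟨i, G.edist_le_one_iff_adj_or_eq.2 (.inl hy.symm), rfl⟩)⟩

theorem le_degree_add_one_of_rainbow [Fintype κ] {G : SimpleGraph V} {x : V}
    [Fintype (G.neighborSet x)] {C : V → κ} {i : κ} (h : ∀ j, j ≠ i → ∃ y, G.Adj x y ∧ C y = j) :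
    Fintype.card κ ≤ G.degree x + 1 := by
  classical
  have hsub : Finset.univ.erase i ⊆ (G.neighborFinset x).image C := fun j hj => by
    obtain ⟨y, hy, rfl⟩ := h j (Finset.ne_of_mem_erase hj)
    exact Finset.mem_image_of_mem C ((G.mem_neighborFinset x y).2 hy)
  have := (Finset.card_le_card hsub).trans Finset.card_image_le
  rwa [Finset.card_erase_of_mem (Finset.mem_univ i), Finset.card_univ,
    G.card_neighborFinset_eq_degree, Nat.sub_le_iff_le_add] at this

end GraphColoring

theorem card_filter_fin_eq_count (P : ℕ → Prop) [DecidablePred P] (n : ℕ) :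
    (Finset.univ.filter fun v : Fin n => P v).card = Nat.count P n := by
  rw [Nat.count_eq_card_filter_range, Finset.card_filter, Finset.card_filter,
    Fin.sum_univ_eq_sum_range fun i => if P i then 1 else 0]

theorem count_le_count_add_count {P Q R : ℕ → Prop} [DecidablePred P] [DecidablePred Q]
    [DecidablePred R] (h : ∀ v, R v → P v ∨ Q v) (n : ℕ) :
    Nat.count R n ≤ Nat.count P n + Nat.count Q n := by
  simp only [Nat.count_eq_card_filter_range]
  refine (Finset.card_le_card fun v hv => ?_).trans (Finset.card_union_le _ _)
  simp only [Finset.mem_union, Finset.mem_filter] at hv ⊢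
  exact (h v hv.2).imp (And.intro hv.1) (And.intro hv.1)

theorem count_and_count_lt (P : ℕ → Prop) [DecidablePred P] (t n : ℕ)
    [DecidablePred fun v => P v ∧ Nat.count P v < t] :
    Nat.count (fun v => P v ∧ Nat.count P v < t) n = min t (Nat.count P n) := by
  induction n with
  | zero => simp
  | succ n ih =>
    rw [Nat.count_succ, ih, Nat.count_succ]
    by_cases hP : P n <;> by_cases hlt : Nat.count P n < t <;> simp [hP, hlt] <;> omega

theorem exists_digits {R M : ℕ} {a : ℕ → ℕ} (ha : ∀ i < M, a i < R) :
    ∃ c < R ^ M, ∀ i < M, c / R ^ i % R = a i := by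
  let c := finFunctionFinEquiv fun i : Fin M => (⟨a i, ha i i.2⟩ : Fin R)
  refine ⟨c, c.2, fun i hi => ?_⟩
  have := congrArg Fin.val (congrFun (finFunctionFinEquiv.symm_apply_apply
    fun i : Fin M => (⟨a i, ha i i.2⟩ : Fin R)) ⟨i, hi⟩)
  rwa [finFunctionFinEquiv_symm_apply_val] at this

theorem exists_digits_rank (P : ℕ → Prop) [DecidablePred P] {n R : ℕ} {a : ℕ → ℕ}
    (ha : ∀ v < n, a v < R) :
    ∃ c < R ^ Nat.count P n, ∀ v < n, P v → c / R ^ Nat.count P v % R = a v := by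
  obtain ⟨c, hc, hdigit⟩ := exists_digits (M := Nat.count P n) (a := fun i => a (Nat.nth P i))
    fun i hi => ha _ (Nat.nth_lt_of_lt_count hi)
  exact ⟨c, hc, fun v hv hP => by
    rw [hdigit _ (Nat.count_strict_mono hP hv), Nat.nth_count hP]⟩

namespace BInstance

open Classical

/-- The adjacency of the graph of an instance, as a relation on natural numbers. -/
def Adj (I : BInstance) (u v : ℕ) : Prop :=
  ∃ (hu : u < I.n) (hv : v < I.n), I.G.Adj ⟨u, hu⟩ ⟨v, hv⟩

/-- The degree of a vertex of an instance. -/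
noncomputable def deg (I : BInstance) (u : ℕ) : ℕ :=
  Nat.count (I.Adj u) I.n

/-- The vertices with at least `k` neighbors. The greedy algorithm can color all the others. -/
def High (I : BInstance) (v : ℕ) : Prop :=
  v < I.n ∧ I.k ≤ I.deg v

/-- The vertices with exactly `k - 1` neighbors, the smallest number with which a vertex can have
neighbors of all the other colors. -/
def Tight (I : BInstance) (v : ℕ) : Prop :=
  v < I.n ∧ I.deg v + 1 = I.k

/-- The maximum degree `Δ`. -/
noncomputable def delta (I : BInstance) : ℕ :=
  maxDeg I.G

/-- The number `ℓ` of vertices of degree at least `k`. -/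
noncomputable def ell (I : BInstance) : ℕ :=
  numHighDeg I.G I.k

/-- The number of colors, capped at the largest number of colors of a `b`-coloring. -/
noncomputable def kappa (I : BInstance) : ℕ :=
  min I.k (I.delta + 1)

/-- A number of tight vertices which is large enough for a greedy choice of centers for all colors
whose neighborhoods do not interact with each other and with the high vertices. -/
noncomputable def threshold (I : BInstance) : ℕ :=
  (I.ell + I.kappa) * (I.delta + 1) ^ 3

/-- The vertices considered as centers of colors: all high vertices, and the first tight ones. -/
def Cand (I : BInstance) (v : ℕ) : Prop :=
  I.High v ∨ I.Tight v ∧ Nat.count I.Tight v < I.threshold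

/-- The number of vertices considered as centers. -/
noncomputable def width (I : BInstance) : ℕ :=
  Nat.count I.Cand I.n

/-- Three numbers whose digits describe the colors of the high vertices, a center for each color,
and a neighbor of each center for each other color. -/
structure Code where
  color : ℕ
  center : ℕ
  nbr : ℕ

/-- The color of a high vertex. -/
noncomputable def colorOf (I : BInstance) (c : Code) (v : ℕ) : ℕ :=
  c.color / I.k ^ Nat.count I.High v % I.k

/-- The center of the color `i`. -/
noncomputable def centerOf (I : BInstance) (c : Code) (i : ℕ) : ℕ :=
  Nat.nth I.Cand (c.center / I.width ^ i % I.width)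

/-- The neighbor of color `j` of the center of the color `i`. -/
noncomputable def nbrOf (I : BInstance) (c : Code) (i j : ℕ) : ℕ :=
  Nat.nth (I.Adj (I.centerOf c i)) (c.nbr / (I.delta + 1) ^ (i * I.k + j) % (I.delta + 1))

/-- The code `c` gives the color `j` to the vertex `v`. -/
def Col (I : BInstance) (c : Code) (v j : ℕ) : Prop :=
  (I.High v ∧ I.colorOf c v = j) ∨ I.centerOf c j = v ∨ ∃ i < I.k, i ≠ j ∧ I.nbrOf c i j = v

/-- The code `c` describes a part of a proper coloring which contains all high vertices and makes
every center adjacent to all the other colors. -/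
structure IsValid (I : BInstance) (c : Code) : Prop where
  color_lt : ∀ v < I.n, I.High v → I.colorOf c v < I.k
  center_lt : ∀ i < I.k, I.centerOf c i < I.n
  adj : ∀ i < I.k, ∀ j < I.k, j ≠ i → I.Adj (I.centerOf c i) (I.nbrOf c i j)
  unique : ∀ v < I.n, ∀ i < I.k, ∀ j < I.k, I.Col c v i → I.Col c v j → i = j
  proper : ∀ u < I.n, ∀ v < I.n, ∀ i < I.k, I.Adj u v → I.Col c u i → ¬ I.Col c v i

/-- The search carried out by the algorithm succeeds. -/
def Accept (I : BInstance) : Prop :=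
  ∃ a < I.kappa ^ I.ell, ∃ b < I.width ^ I.kappa, ∃ c < (I.delta + 1) ^ (I.kappa * I.kappa),
    I.IsValid ⟨a, b, c⟩

variable {I : BInstance} {c : Code} {u v : ℕ}

theorem Adj.left_lt (h : I.Adj u v) : u < I.n :=
  h.1

theorem Adj.right_lt (h : I.Adj u v) : v < I.n :=
  h.2.1

theorem adj_coe {u v : Fin I.n} : I.Adj u v ↔ I.G.Adj u v :=
  ⟨fun ⟨_, _, h⟩ => h, fun h => ⟨u.2, v.2, h⟩⟩

theorem deg_coe (v : Fin I.n) : I.deg v = I.G.degree v := by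
  rw [deg, ← card_filter_fin_eq_count, ← I.G.card_neighborFinset_eq_degree,
    I.G.neighborFinset_eq_filter]
  simp only [adj_coe]

theorem high_coe {v : Fin I.n} : I.High v ↔ I.k ≤ I.G.degree v := by
  rw [High, deg_coe, and_iff_right v.2]

theorem tight_coe {v : Fin I.n} : I.Tight v ↔ I.G.degree v + 1 = I.k := by
  rw [Tight, deg_coe, and_iff_right v.2]

theorem ell_eq_count : I.ell = Nat.count I.High I.n := by
  rw [ell, numHighDeg, ← card_filter_fin_eq_count]
  simp only [high_coe]

theorem lt_delta_iff {d : ℕ} : d < I.delta ↔ ∃ v < I.n, d < I.deg v := by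
  constructor
  · intro h
    by_contra! hle
    exact h.not_ge (I.G.maxDegree_le_of_forall_degree_le d fun v => deg_coe v ▸ hle v v.2)
  · rintro ⟨v, hv, hd⟩
    exact hd.trans_le ((deg_coe ⟨v, hv⟩).trans_le (I.G.degree_le_maxDegree _))

theorem count_adj_le_delta {m : ℕ} : Nat.count (I.Adj u) m ≤ I.delta := by
  by_contra! h
  obtain ⟨v, -, hv⟩ := Nat.count_ne_iff_exists.1 (Nat.ne_zero_of_lt h)
  refine (lt_delta_iff.2 ⟨u, hv.left_lt, h.trans_le ?_⟩).false
  rw [deg, Nat.count_eq_card_filter_range, Nat.count_eq_card_filter_range]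
  exact Finset.card_le_card fun w hw => Finset.mem_filter.2
    ⟨Finset.mem_range.2 (Finset.mem_filter.1 hw).2.right_lt, (Finset.mem_filter.1 hw).2⟩

theorem delta_le : I.delta ≤ I.n :=
  I.G.maxDegree_le_of_forall_degree_le _ fun v =>
    (I.G.degree_lt_card_verts v).le.trans_eq (Fintype.card_fin _)

theorem Cand.lt (h : I.Cand v) : v < I.n :=
  h.elim And.left fun h => h.1.1

theorem width_le : I.width ≤ I.ell + I.threshold := by
  calc I.width ≤ Nat.count I.High I.n +
        Nat.count (fun v => I.Tight v ∧ Nat.count I.Tight v < I.threshold) I.n :=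
        count_le_count_add_count (R := I.Cand) (fun _ => id) _
    _ = I.ell + min I.threshold (Nat.count I.Tight I.n) := by
        rw [ell_eq_count, count_and_count_lt]
    _ ≤ I.ell + I.threshold := Nat.add_le_add_left (min_le_left _ _) _

theorem IsValid.hasBColoring (h : I.IsValid c) : HasBColoring I.G I.k := by
  have hcol : IsPartialColoring I.G fun v (j : Fin I.k) => I.Col c v j :=
    ⟨fun v i j hi hj => Fin.ext (h.unique v v.2 i i.2 j j.2 hi hj),
      fun u v i huv => h.proper u u.2 v v.2 i i.2 (adj_coe.2 huv)⟩
  obtain ⟨C, hC⟩ := hcol.exists_coloring fun v => by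
    rw [Fintype.card_fin, ← not_le, ← high_coe, or_iff_not_imp_right, not_not]
    exact fun hv => ⟨⟨I.colorOf c v, h.color_lt v v.2 hv⟩, .inl ⟨hv, rfl⟩⟩
  refine ⟨C, fun i => ⟨⟨I.centerOf c i, h.center_lt i i.2⟩, hC _ _ (.inr (.inl rfl)),
    fun j hj => ?_⟩⟩
  obtain ⟨_, hlt, hadj⟩ := h.adj i i.2 j j.2 (Fin.val_ne_of_ne hj)
  exact ⟨⟨I.nbrOf c i j, hlt⟩, hadj,
    hC _ _ (.inr (.inr ⟨i, i.2, (Fin.val_ne_of_ne hj).symm, rfl⟩))⟩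

/-- A `b`-coloring `C` of an instance, together with a candidate `x i` as the center of each color
`i` and a neighbor `y i j` of this center of each other color `j`. -/
structure IsWitness (I : BInstance) (C x : ℕ → ℕ) (y : ℕ → ℕ → ℕ) : Prop where
  color_lt : ∀ v < I.n, C v < I.k
  proper : ∀ u v, I.Adj u v → C u ≠ C v
  cand : ∀ i < I.k, I.Cand (x i)
  color_center : ∀ i < I.k, C (x i) = i
  adj : ∀ i < I.k, ∀ j < I.k, j ≠ i → I.Adj (x i) (y i j)
  color_nbr : ∀ i < I.k, ∀ j < I.k, j ≠ i → C (y i j) = j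

theorem le_delta_add_one (h : HasBColoring I.G I.k) : I.k ≤ I.delta + 1 := by
  obtain ⟨C, hC⟩ := h
  rcases Nat.eq_zero_or_pos I.k with h0 | hpos
  · exact h0.trans_le (Nat.zero_le _)
  · obtain ⟨x, -, hx⟩ := hC ⟨0, hpos⟩
    calc I.k = Fintype.card (Fin I.k) := (Fintype.card_fin _).symm
      _ ≤ I.G.degree x + 1 := le_degree_add_one_of_rainbow hx
      _ ≤ I.delta + 1 := Nat.add_le_add_right (I.G.degree_le_maxDegree x) 1

theorem exists_bColoring_cand (h : HasBColoring I.G I.k) :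
    ∃ C : I.G.Coloring (Fin I.k), ∀ i, ∃ x : Fin I.n, I.Cand x ∧ C x = i ∧
      ∀ j, j ≠ i → ∃ y, I.G.Adj x y ∧ C y = j := by
  rcases le_or_gt (Nat.count I.Tight I.n) I.threshold with hfew | hmany
  · obtain ⟨C, hC⟩ := h
    refine ⟨C, fun i => (hC i).imp fun x ⟨hx, hrainbow⟩ => ⟨?_, hx, hrainbow⟩⟩
    rcases le_or_gt I.k (I.G.degree x) with hdeg | hdeg
    · exact .inl (high_coe.2 hdeg)
    · have hle := le_degree_add_one_of_rainbow hrainbow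
      rw [Fintype.card_fin] at hle
      have htight : I.Tight x := tight_coe.2 (hle.antisymm hdeg).symm
      exact .inr ⟨htight, (Nat.count_strict_mono htight x.2).trans_le hfew⟩
  · have hkappa : I.kappa = I.k := min_eq_left (le_delta_add_one h)
    let S := Finset.univ.filter fun v : Fin I.n => I.Tight v ∧ Nat.count I.Tight v < I.threshold
    have hS : S.card = (I.ell + I.k) * (I.delta + 1) ^ 3 := by
      rw [card_filter_fin_eq_count fun v => I.Tight v ∧ Nat.count I.Tight v < I.threshold,
        count_and_count_lt, min_eq_left hmany.le, threshold, hkappa]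
    obtain ⟨C, hC⟩ := exists_bColoring_of_many_tight h.choose (S := S)
      (fun v hv => tight_coe.1 (Finset.mem_filter.1 hv).2.1) hS.ge
    exact ⟨C, fun i => (hC i).imp fun x ⟨hx, hcolor⟩ => ⟨.inr (Finset.mem_filter.1 hx).2, hcolor⟩⟩

theorem exists_isWitness (h : HasBColoring I.G I.k) : ∃ C x y, I.IsWitness C x y := by
  obtain ⟨C, hC⟩ := exists_bColoring_cand h
  let C' (v : ℕ) : ℕ := if hv : v < I.n then C ⟨v, hv⟩ else 0
  have hC' (v : Fin I.n) : C' v = C v := dif_pos v.2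
  have hcenter (i : ℕ) (hi : i < I.k) : ∃ x : ℕ, I.Cand x ∧ C' x = i ∧
      ∀ j < I.k, j ≠ i → ∃ y, I.Adj x y ∧ C' y = j := by
    obtain ⟨x, hx, hxi, hrainbow⟩ := hC ⟨i, hi⟩
    refine ⟨x, hx, by rw [hC', hxi], fun j hj hij => ?_⟩
    obtain ⟨y, hadj, hyj⟩ := hrainbow ⟨j, hj⟩ (by simpa using hij)
    exact ⟨y, adj_coe.2 hadj, by rw [hC', hyj]⟩
  choose! x hcand hx hrainbow using hcenter
  choose! y hadj hy using hrainbow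
  refine ⟨C', x, y, fun v hv => ?_, fun u v ⟨hu, hv, huv⟩ => ?_, hcand, hx, hadj, hy⟩
  · exact (hC' ⟨v, hv⟩).trans_lt (C ⟨v, hv⟩).2
  · have hne := Fin.val_ne_of_ne (C.valid huv)
    rwa [← hC', ← hC'] at hne

namespace IsWitness

variable {C x : ℕ → ℕ} {y : ℕ → ℕ → ℕ}

theorem exists_code (h : I.IsWitness C x y) :
    ∃ a < I.k ^ I.ell, ∃ b < I.width ^ I.k, ∃ d < (I.delta + 1) ^ (I.k * I.k),
      (∀ v < I.n, I.High v → I.colorOf ⟨a, b, d⟩ v = C v) ∧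
      (∀ i < I.k, I.centerOf ⟨a, b, d⟩ i = x i) ∧
      ∀ i < I.k, ∀ j < I.k, j ≠ i → I.nbrOf ⟨a, b, d⟩ i j = y i j := by
  obtain ⟨a, ha, hcolor⟩ := exists_digits_rank I.High h.color_lt
  obtain ⟨b, hb, hcenter⟩ := exists_digits (a := fun i => Nat.count I.Cand (x i)) (R := I.width)
    fun i hi => Nat.count_strict_mono (h.cand i hi) (h.cand i hi).lt
  obtain ⟨d, hd, hnbr⟩ := exists_digits (M := I.k * I.k) (R := I.delta + 1)
    (a := fun p => Nat.count (I.Adj (x (p / I.k))) (y (p / I.k) (p % I.k)))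
    fun _ _ => Nat.lt_succ_of_le count_adj_le_delta
  rw [← ell_eq_count] at ha
  have hcenterOf (i : ℕ) (hi : i < I.k) : I.centerOf ⟨a, b, d⟩ i = x i := by
    rw [centerOf, hcenter i hi, Nat.nth_count (h.cand i hi)]
  refine ⟨a, ha, b, hb, d, hd, hcolor, hcenterOf, fun i hi j hj hij => ?_⟩
  have hpos : i * I.k + j < I.k * I.k := by nlinarith
  have hk : 0 < I.k := by omega
  rw [nbrOf, hnbr _ hpos, hcenterOf i hi, Nat.mul_comm i, Nat.mul_add_div hk, Nat.mul_add_mod,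
    Nat.div_eq_of_lt hj, Nat.mod_eq_of_lt hj, add_zero, Nat.nth_count (h.adj i hi j hj hij)]

theorem eq_of_col (h : I.IsWitness C x y) (hcolor : ∀ v < I.n, I.High v → I.colorOf c v = C v)
    (hcenter : ∀ i < I.k, I.centerOf c i = x i)
    (hnbr : ∀ i < I.k, ∀ j < I.k, j ≠ i → I.nbrOf c i j = y i j) {j : ℕ} (hj : j < I.k)
    (hcol : I.Col c v j) : C v = j := by
  rcases hcol with ⟨hv, rfl⟩ | rfl | ⟨i, hi, hij, rfl⟩
  · exact (hcolor v hv.1 hv).symm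
  · rw [hcenter j hj, h.color_center j hj]
  · rw [hnbr i hi j hj hij.symm, h.color_nbr i hi j hj hij.symm]

theorem isValid (h : I.IsWitness C x y) (hcolor : ∀ v < I.n, I.High v → I.colorOf c v = C v)
    (hcenter : ∀ i < I.k, I.centerOf c i = x i)
    (hnbr : ∀ i < I.k, ∀ j < I.k, j ≠ i → I.nbrOf c i j = y i j) : I.IsValid c where
  color_lt v hv hhigh := (hcolor v hv hhigh).trans_lt (h.color_lt v hv)
  center_lt i hi := (hcenter i hi).trans_lt (h.cand i hi).lt
  adj i hi j hj hij := by rw [hcenter i hi, hnbr i hi j hj hij]; exact h.adj i hi j hj hij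
  unique v _ i hi j hj hvi hvj :=
    (h.eq_of_col hcolor hcenter hnbr hi hvi).symm.trans (h.eq_of_col hcolor hcenter hnbr hj hvj)
  proper u _ v _ i hi huv hui hvi := h.proper u v huv <|
    (h.eq_of_col hcolor hcenter hnbr hi hui).trans (h.eq_of_col hcolor hcenter hnbr hi hvi).symm

end IsWitness

theorem accept_iff : I.Accept ↔ HasBColoring I.G I.k := by
  refine ⟨fun ⟨a, _, b, _, c, _, h⟩ => h.hasBColoring, fun h => ?_⟩
  obtain ⟨C, x, y, hw⟩ := exists_isWitness h
  obtain ⟨a, ha, b, hb, d, hd, hcolor, hcenter, hnbr⟩ := hw.exists_code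
  rw [Accept, show I.kappa = I.k from min_eq_left (le_delta_add_one h)]
  exact ⟨a, ha, b, hb, d, hd, hw.isValid hcolor hcenter hnbr⟩

open RAM

section Computation

theorem input_arr_le_one {I : BInstance} {a m : ℕ} : I.input.arr a m ≤ 1 := by
  simp only [input]
  split <;> simp

theorem adj_iff {I : BInstance} {u v : ℕ} :
    I.Adj u v ↔ (u < I.n ∧ v < I.n) ∧ I.input.arr 0 (u * I.n + v) = 1 := by
  simp only [input, true_and, ite_eq_left_iff, zero_ne_one, imp_false, not_not]
  constructor
  · exact fun ⟨hu, hv, huv⟩ => ⟨⟨hu, hv⟩, _, _, huv, rfl⟩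
  · rintro ⟨⟨hu, hv⟩, i, j, hij, heq⟩
    have hj := congrArg (· % I.n) heq
    have hi := congrArg (· / I.n) heq
    simp only [Nat.mul_add_mod', Nat.mod_eq_of_lt hv, Nat.mod_eq_of_lt j.2] at hj
    simp only [Nat.add_comm (_ * I.n), Nat.add_mul_div_right _ _ (Nat.zero_lt_of_lt hv),
      Nat.div_eq_of_lt hv, Nat.div_eq_of_lt j.2, zero_add] at hi
    subst hi hj
    exact ⟨hu, hv, hij⟩

variable {α : Type*} [Environment α] {I : α → BInstance} {c : α → Code} {f g : α → ℕ}

/-- The environment `α` gives access to the instance `I x`. -/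
structure HoldsInstance (I : α → BInstance) : Prop where
  n : PolyTime fun x => (I x).n
  k : PolyTime fun x => (I x).k
  cells_eq : ∀ x, Environment.cells x = (I x).input.arr 0

namespace HoldsInstance

theorem comp_fst (h : HoldsInstance I) : HoldsInstance fun x : α × ℕ => I x.1 :=
  ⟨h.n.comp_fst, h.k.comp_fst, fun x => h.cells_eq x.1⟩

theorem adj (h : HoldsInstance I) (hf : PolyTime f) (hg : PolyTime g) :
    PolyTimePred fun x => (I x).Adj (f x) (g x) := by
  have hcell (x : α) := congrFun (h.cells_eq x) (f x * (I x).n + g x)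
  have hload : PolyTime fun x => Environment.cells x (f x * (I x).n + g x) :=
    .load ((hf.mul h.n).add hg) <| (PolyBounded.const 1).mono fun x =>
      (hcell x).trans_le input_arr_le_one
  exact (((PolyTimePred.lt hf h.n).and (.lt hg h.n)).and (.eq hload (.const 1))).of_iff
    fun x => by rw [hcell, adj_iff]

theorem deg (h : HoldsInstance I) (hf : PolyTime f) : PolyTime fun x => (I x).deg (f x) :=
  .count (P := fun x => (I x).Adj (f x)) (h.comp_fst.adj hf.comp_fst .snd) h.n

theorem high (h : HoldsInstance I) (hf : PolyTime f) : PolyTimePred fun x => (I x).High (f x) :=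
  (PolyTimePred.lt hf h.n).and (.le h.k (h.deg hf))

theorem tight (h : HoldsInstance I) (hf : PolyTime f) : PolyTimePred fun x => (I x).Tight (f x) :=
  (PolyTimePred.lt hf h.n).and (.eq ((h.deg hf).add (.const 1)) h.k)

theorem delta (h : HoldsInstance I) : PolyTime fun x => (I x).delta :=
  .of_hypograph h.n (fun _ => delta_le) <|
    (PolyTimePred.exists_lt (P := fun (y : α × ℕ) v => y.2 < (I y.1).deg v)
      (.lt PolyTime.snd.comp_fst (h.comp_fst.comp_fst.deg .snd)) h.comp_fst.n).of_iff
        fun _ => lt_delta_iff.symm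

theorem ell (h : HoldsInstance I) : PolyTime fun x => (I x).ell :=
  (PolyTime.count (P := fun x => (I x).High) (h.comp_fst.high .snd) h.n).of_eq
    fun _ => ell_eq_count.symm

theorem kappa (h : HoldsInstance I) : PolyTime fun x => (I x).kappa :=
  (h.k.sub (h.k.sub (h.delta.add (.const 1)))).of_eq fun _ => tsub_tsub_eq_min _ _

theorem threshold (h : HoldsInstance I) : PolyTime fun x => (I x).threshold :=
  have hdelta := h.delta.add (.const 1)
  (h.ell.add h.kappa).mul (hdelta.pow (.const 3) (hdelta.polyBounded.pow_const 3))

theorem cand (h : HoldsInstance I) (hf : PolyTime f) : PolyTimePred fun x => (I x).Cand (f x) :=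
  (h.high hf).or <| (h.tight hf).and <|
    .lt (.count (P := fun x => (I x).Tight) (h.comp_fst.tight .snd) hf) h.threshold

theorem width (h : HoldsInstance I) : PolyTime fun x => (I x).width :=
  .count (P := fun x => (I x).Cand) (h.comp_fst.cand .snd) h.n

end HoldsInstance

/-- The environment `α` gives access to the instance `I x` and to the code `c x`. -/
structure HoldsCode (I : α → BInstance) (c : α → Code) : Prop extends HoldsInstance I where
  color : PolyTime fun x => (c x).color
  center : PolyTime fun x => (c x).center
  nbr : PolyTime fun x => (c x).nbr

namespace HoldsCode

theorem comp_fst (h : HoldsCode I c) : HoldsCode (fun x : α × ℕ => I x.1) fun x => c x.1 where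
  toHoldsInstance := h.toHoldsInstance.comp_fst
  color := h.color.comp_fst
  center := h.center.comp_fst
  nbr := h.nbr.comp_fst

theorem colorOf (h : HoldsCode I c) (hf : PolyTime f) :
    PolyTime fun x => (I x).colorOf (c x) (f x) :=
  have hrank : PolyTime fun x => Nat.count (I x).High (f x) :=
    .count (P := fun x => (I x).High) (h.toHoldsInstance.comp_fst.high .snd) hf
  (h.color.div_pow h.k hrank).mod h.k

theorem centerOf (h : HoldsCode I c) (hf : PolyTime f) :
    PolyTime fun x => (I x).centerOf (c x) (f x) :=
  .nth (P := fun x => (I x).Cand) (h.toHoldsInstance.comp_fst.cand .snd) h.n (fun _ _ => Cand.lt)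
    ((h.center.div_pow h.width hf).mod h.width)

theorem nbrOf (h : HoldsCode I c) (hf : PolyTime f) (hg : PolyTime g) :
    PolyTime fun x => (I x).nbrOf (c x) (f x) (g x) :=
  have hdelta := h.delta.add (.const 1)
  .nth (P := fun x => (I x).Adj ((I x).centerOf (c x) (f x)))
    (h.toHoldsInstance.comp_fst.adj (h.centerOf hf).comp_fst .snd) h.n (fun _ _ => Adj.right_lt)
    ((h.nbr.div_pow hdelta ((hf.mul h.k).add hg)).mod hdelta)

theorem col (h : HoldsCode I c) (hf : PolyTime f) (hg : PolyTime g) :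
    PolyTimePred fun x => (I x).Col (c x) (f x) (g x) :=
  ((h.high hf).and (.eq (h.colorOf hf) hg)).or <| .or (.eq (h.centerOf hg) hf) <|
    .exists_lt (P := fun x i => i ≠ g x ∧ (I x).nbrOf (c x) i (g x) = f x)
      (.and (.ne .snd hg.comp_fst) (.eq (h.comp_fst.nbrOf .snd hg.comp_fst) hf.comp_fst)) h.k

theorem isValid (h : HoldsCode I c) : PolyTimePred fun x => (I x).IsValid (c x) := by
  have color_lt : PolyTimePred fun x => ∀ v < (I x).n, (I x).High v →
      (I x).colorOf (c x) v < (I x).k :=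
    .forall_lt (.imp (h.comp_fst.high .snd) (.lt (h.comp_fst.colorOf .snd) h.comp_fst.k)) h.n
  have center_lt : PolyTimePred fun x => ∀ i < (I x).k, (I x).centerOf (c x) i < (I x).n :=
    .forall_lt (.lt (h.comp_fst.centerOf .snd) h.comp_fst.n) h.k
  have adj : PolyTimePred fun x => ∀ i < (I x).k, ∀ j < (I x).k, j ≠ i →
      (I x).Adj ((I x).centerOf (c x) i) ((I x).nbrOf (c x) i j) :=
    .forall_lt (.forall_lt (.imp (.ne .snd PolyTime.snd.comp_fst)
      (h.comp_fst.comp_fst.adj (h.comp_fst.comp_fst.centerOf PolyTime.snd.comp_fst)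
        (h.comp_fst.comp_fst.nbrOf PolyTime.snd.comp_fst .snd))) h.comp_fst.k) h.k
  have inner := h.comp_fst.comp_fst.comp_fst
  have fst_var : PolyTime fun y : ((α × ℕ) × ℕ) × ℕ => y.1.1.2 := PolyTime.snd.comp_fst.comp_fst
  have snd_var : PolyTime fun y : ((α × ℕ) × ℕ) × ℕ => y.1.2 := PolyTime.snd.comp_fst
  have unique : PolyTimePred fun x => ∀ v < (I x).n, ∀ i < (I x).k, ∀ j < (I x).k,
      (I x).Col (c x) v i → (I x).Col (c x) v j → i = j :=
    .forall_lt (.forall_lt (.forall_lt (.imp (inner.col fst_var snd_var)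
      (.imp (inner.col fst_var .snd) (.eq snd_var .snd))) h.comp_fst.comp_fst.k) h.comp_fst.k) h.n
  have proper : PolyTimePred fun x => ∀ u < (I x).n, ∀ v < (I x).n, ∀ i < (I x).k,
      (I x).Adj u v → (I x).Col (c x) u i → ¬ (I x).Col (c x) v i :=
    .forall_lt (.forall_lt (.forall_lt (.imp (inner.adj fst_var snd_var)
      (.imp (inner.col fst_var .snd) (.not (inner.col snd_var .snd))))
      h.comp_fst.comp_fst.k) h.comp_fst.n) h.n
  exact (color_lt.and (center_lt.and (adj.and (unique.and proper)))).of_iff fun x =>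
    ⟨fun ⟨hcolor, hcenter, hadj, hunique, hproper⟩ => ⟨hcolor, hcenter, hadj, hunique, hproper⟩,
      fun hx => ⟨hx.color_lt, hx.center_lt, hx.adj, hx.unique, hx.proper⟩⟩

end HoldsCode

theorem HoldsInstance.accept (h : HoldsInstance I)
    (hcolor : PolyBounded fun x => (I x).kappa ^ (I x).ell)
    (hcenter : PolyBounded fun x => (I x).width ^ (I x).kappa)
    (hnbr : PolyBounded fun x => ((I x).delta + 1) ^ ((I x).kappa * (I x).kappa)) :
    PolyTimePred fun x => (I x).Accept :=
  have hcode : HoldsCode (fun y : ((α × ℕ) × ℕ) × ℕ => I y.1.1.1)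
      fun y => ⟨y.1.1.2, y.1.2, y.2⟩ :=
    { toHoldsInstance := h.comp_fst.comp_fst.comp_fst
      color := PolyTime.snd.comp_fst.comp_fst
      center := PolyTime.snd.comp_fst
      nbr := PolyTime.snd }
  .exists_lt (.exists_lt (.exists_lt hcode.isValid
    ((h.delta.add (.const 1)).pow (h.kappa.mul h.kappa) hnbr).comp_fst.comp_fst)
    (h.width.pow h.kappa hcenter).comp_fst) (h.kappa.pow h.ell hcolor)

end Computation

/-- A bound for the size of the search space and for the numbers in the input. -/
noncomputable def searchSize (I : BInstance) : ℕ :=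
  I.n + 2 + I.kappa ^ I.ell + I.width ^ I.kappa + (I.delta + 1) ^ (I.kappa * I.kappa)

/-- The exponent, up to a constant factor, in the stated running time. -/
def exponent (k Δ ℓ : ℕ) : ℕ :=
  if k < ℓ then ℓ * Δ * min ℓ Δ ^ (ℓ + 1) else min k (Δ + 1) ^ 4 * Δ

theorem exponent_of_lt {k Δ ℓ : ℕ} (h : k < ℓ) :
    exponent k Δ ℓ = ℓ * Δ * min ℓ Δ ^ (ℓ + 1) :=
  if_pos h

theorem exponent_of_le {k Δ ℓ : ℕ} (h : ℓ ≤ k) : exponent k Δ ℓ = min k (Δ + 1) ^ 4 * Δ :=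
  if_neg h.not_gt

theorem le_exponent_of_lt {k Δ ℓ : ℕ} (hk : k < ℓ) (hkΔ : k ≤ Δ) :
    k * (2 * ℓ + k + 3 * Δ) + Δ * (k * k) ≤ 7 * exponent k Δ ℓ := by
  rcases Nat.eq_zero_or_pos k with rfl | hpos
  · simp
  have hℓ : 1 ≤ ℓ := by omega
  have hΔ : 1 ≤ Δ := by omega
  have hX : ℓ * Δ * k ^ 3 ≤ exponent k Δ ℓ := by
    have hmin : k ≤ min ℓ Δ := le_min hk.le hkΔ
    calc ℓ * Δ * k ^ 3 ≤ ℓ * Δ * min ℓ Δ ^ 3 := by gcongr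
      _ ≤ ℓ * Δ * min ℓ Δ ^ (ℓ + 1) := Nat.mul_le_mul_left _
          (Nat.pow_le_pow_right (hpos.trans_le hmin) (by omega))
      _ = exponent k Δ ℓ := (exponent_of_lt hk).symm
  have h₁ : ℓ * 1 * k ^ 1 ≤ ℓ * Δ * k ^ 3 := by gcongr; omega
  have h₂ : 1 * 1 * k ^ 2 ≤ ℓ * Δ * k ^ 3 := by gcongr; omega
  have h₃ : 1 * Δ * k ^ 1 ≤ ℓ * Δ * k ^ 3 := by gcongr; omega
  have h₄ : 1 * Δ * k ^ 2 ≤ ℓ * Δ * k ^ 3 := by gcongr; omega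
  calc k * (2 * ℓ + k + 3 * Δ) + Δ * (k * k)
      = 2 * (ℓ * 1 * k ^ 1) + 1 * 1 * k ^ 2 + 3 * (1 * Δ * k ^ 1) + 1 * Δ * k ^ 2 := by ring
    _ ≤ 7 * exponent k Δ ℓ := by omega

theorem le_exponent_of_le {k Δ ℓ κ : ℕ} (hκ : κ = min k (Δ + 1)) (hk : ℓ ≤ k) (hℓ : ℓ ≤ κ) :
    κ * (2 * ℓ + κ + 3 * Δ) + Δ * (κ * κ) ≤ 7 * exponent k Δ ℓ + 3 := by
  rw [exponent_of_le hk, ← hκ]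
  rcases Nat.eq_zero_or_pos κ with rfl | hpos
  · simp
  rcases Nat.eq_zero_or_pos Δ with rfl | hΔ
  · have : κ = 1 := by omega
    subst this
    omega
  have h₁ : κ ^ 2 * 1 ≤ κ ^ 4 * Δ := by gcongr <;> omega
  have h₂ : κ ^ 1 * Δ ≤ κ ^ 4 * Δ := by gcongr; omega
  have h₃ : κ ^ 2 * Δ ≤ κ ^ 4 * Δ := by gcongr; omega
  calc κ * (2 * ℓ + κ + 3 * Δ) + Δ * (κ * κ)
      ≤ κ * (2 * κ + κ + 3 * Δ) + Δ * (κ * κ) := by gcongr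
    _ = 3 * (κ ^ 2 * 1) + 3 * (κ ^ 1 * Δ) + κ ^ 2 * Δ := by ring
    _ ≤ 7 * (κ ^ 4 * Δ) + 3 := by omega

theorem le_delta_or_ell_eq_zero : I.k ≤ I.delta ∨ I.ell = 0 := by
  classical
  rw [or_iff_not_imp_right, ell_eq_count]
  intro h
  obtain ⟨v, -, hv⟩ := Nat.count_ne_iff_exists.1 h
  exact hv.2.trans count_adj_le_delta

theorem searchSize_exponent_le :
    I.kappa * (2 * I.ell + I.kappa + 3 * I.delta) + I.delta * (I.kappa * I.kappa) ≤
      7 * exponent I.k I.delta I.ell + 3 := by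
  have h := I.le_delta_or_ell_eq_zero
  rcases lt_or_ge I.k I.ell with hk | hk
  · have hkΔ : I.k ≤ I.delta := by omega
    rw [kappa, min_eq_left (by omega)]
    exact (le_exponent_of_lt hk hkΔ).trans (Nat.le_add_right _ _)
  · exact le_exponent_of_le rfl hk (le_min hk (by omega))

theorem width_le_two_pow : I.width ≤ 2 ^ (2 * I.ell + I.kappa + 3 * I.delta) := by
  have hΔ : I.delta + 1 ≤ 2 ^ I.delta := Nat.lt_two_pow_self
  calc I.width ≤ I.ell + (I.ell + I.kappa) * (I.delta + 1) ^ 3 := width_le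
    _ ≤ (2 * I.ell + I.kappa) * (I.delta + 1) ^ 3 := by
        nlinarith [Nat.one_le_pow 3 (I.delta + 1) (Nat.succ_pos _)]
    _ ≤ 2 ^ (2 * I.ell + I.kappa) * (2 ^ I.delta) ^ 3 :=
        Nat.mul_le_mul Nat.lt_two_pow_self.le (Nat.pow_le_pow_left hΔ 3)
    _ = 2 ^ (2 * I.ell + I.kappa + 3 * I.delta) := by rw [← pow_mul, ← pow_add, mul_comm 3]

theorem searchSize_le : I.searchSize ≤ ((I.n + 2) * 2 ^ exponent I.k I.delta I.ell) ^ 7 := by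
  set E := I.kappa * (2 * I.ell + I.kappa + 3 * I.delta) + I.delta * (I.kappa * I.kappa) with hE
  have hcolor : I.kappa ^ I.ell ≤ 2 ^ E :=
    calc I.kappa ^ I.ell ≤ (2 ^ I.kappa) ^ I.ell := Nat.pow_le_pow_left Nat.lt_two_pow_self.le _
      _ = 2 ^ (I.kappa * I.ell) := (pow_mul _ _ _).symm
      _ ≤ 2 ^ E := Nat.pow_le_pow_right two_pos (by rw [hE]; nlinarith)
  have hcenter : I.width ^ I.kappa ≤ 2 ^ E :=
    calc I.width ^ I.kappa ≤ (2 ^ (2 * I.ell + I.kappa + 3 * I.delta)) ^ I.kappa :=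
          Nat.pow_le_pow_left width_le_two_pow _
      _ = 2 ^ (I.kappa * (2 * I.ell + I.kappa + 3 * I.delta)) := by rw [← pow_mul, mul_comm]
      _ ≤ 2 ^ E := Nat.pow_le_pow_right two_pos (Nat.le_add_right _ _)
  have hnbr : (I.delta + 1) ^ (I.kappa * I.kappa) ≤ 2 ^ E :=
    calc (I.delta + 1) ^ (I.kappa * I.kappa) ≤ (2 ^ I.delta) ^ (I.kappa * I.kappa) :=
          Nat.pow_le_pow_left Nat.lt_two_pow_self _
      _ = 2 ^ (I.delta * (I.kappa * I.kappa)) := (pow_mul _ _ _).symm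
      _ ≤ 2 ^ E := Nat.pow_le_pow_right two_pos (Nat.le_add_left _ _)
  have hE1 : 1 ≤ 2 ^ E := Nat.one_le_two_pow
  have hn : 8 ≤ (I.n + 2) ^ 4 :=
    le_trans (by norm_num) (Nat.pow_le_pow_left (Nat.le_add_left 2 I.n) 4)
  calc I.searchSize ≤ I.n + 2 + 2 ^ E + 2 ^ E + 2 ^ E := by rw [searchSize]; gcongr
    _ ≤ (I.n + 5) * 2 ^ E := by nlinarith
    _ ≤ (I.n + 2) ^ 3 * 2 ^ E := Nat.mul_le_mul_right _ (by ring_nf; omega)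
    _ ≤ (I.n + 2) ^ 3 * 2 ^ (7 * exponent I.k I.delta I.ell + 3) :=
        Nat.mul_le_mul_left _ (Nat.pow_le_pow_right two_pos searchSize_exponent_le)
    _ = (I.n + 2) ^ 3 * 2 ^ (7 * exponent I.k I.delta I.ell) * 8 := by rw [pow_add]; ring
    _ ≤ (I.n + 2) ^ 3 * 2 ^ (7 * exponent I.k I.delta I.ell) * (I.n + 2) ^ 4 :=
        Nat.mul_le_mul_left _ hn
    _ = ((I.n + 2) * 2 ^ exponent I.k I.delta I.ell) ^ 7 := by ring

/-- Register `0` holds `n`, register `1` holds `k`, and array `0` holds the adjacency matrix. With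
more colors than vertices, the value `k` would not be bounded by the size of the search. -/
noncomputable instance : Environment {I : BInstance // I.k ≤ I.n} where
  Var := Fin 2
  value I := ![I.1.n, I.1.k]
  cells I := I.1.input.arr 0
  bound I := I.1.searchSize
  two_le_bound I := by rw [searchSize]; omega

theorem polyTimePred_accept :
    PolyTimePred fun I : {I : BInstance // I.k ≤ I.n} => I.1.Accept := by
  have of_le {f : {I : BInstance // I.k ≤ I.n} → ℕ} (h : ∀ I, f I ≤ I.1.searchSize) :
      PolyBounded f := PolyBounded.bound.mono h
  have hI : HoldsInstance fun I : {I : BInstance // I.k ≤ I.n} => I.1 :=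
    { n := .value (α := {I : BInstance // I.k ≤ I.n}) (0 : Fin 2)
        (of_le fun I => by change I.1.n ≤ _; rw [searchSize]; omega)
      k := .value (α := {I : BInstance // I.k ≤ I.n}) (1 : Fin 2)
        (of_le fun I => by have := I.2; change I.1.k ≤ _; rw [searchSize]; omega)
      cells_eq := fun _ => rfl }
  exact hI.accept (of_le fun I => by rw [searchSize]; omega)
    (of_le fun I => by rw [searchSize]; omega) (of_le fun I => by rw [searchSize]; omega)

theorem le_of_hasBColoring (h : HasBColoring I.G I.k) : I.k ≤ I.n := by
  obtain ⟨C, hC⟩ := h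
  have := Fintype.card_le_of_surjective C fun i => (hC i).imp fun _ hx => hx.1
  rwa [Fintype.card_fin, Fintype.card_fin] at this

theorem exists_program_searchSize :
    ∃ p c, ∀ I : BInstance, DecidesInTime p I.input (HasBColoring I.G I.k) (I.searchSize ^ c) := by
  obtain ⟨-, T, hT, hprogram⟩ := polyTimePred_accept
  obtain ⟨p, hp⟩ := hprogram Fin.val 2 Fin.isLt
  obtain ⟨c, hc⟩ := hT.add (.const 2)
  refine ⟨.ifLt 0 1 (.const 0 0) (.seq p (.copy 0 2)), c + 1, fun I => ?_⟩
  have hsize : 2 ≤ I.searchSize := by rw [searchSize]; omega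
  by_cases hk : I.n < I.k
  · exact ⟨_, _, .ifTrue hk (.const _ 0 0), hsize.trans (Nat.le_self_pow c.succ_ne_zero _),
      fun h => absurd (le_of_hasBColoring h) hk.not_ge, fun _ => by simp⟩
  · obtain ⟨s, hrun, -, hs⟩ := hp ⟨I, not_lt.1 hk⟩ I.input ⟨Fin.forall_fin_two.2 ⟨rfl, rfl⟩, rfl⟩
    obtain ⟨t, ht, hrun⟩ := (hrun.seq (Runs.copy s 0 2).runsWithin).ifFalse
      (show ¬I.input.reg 0 < I.input.reg 1 from hk)
    refine ⟨_, t, hrun, ht.trans ((hc ⟨I, not_lt.1 hk⟩).trans ?_), fun h => ?_, fun h => ?_⟩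
    · exact Nat.pow_le_pow_right (Nat.zero_lt_of_lt hsize) c.le_succ
    · exact (State.reg_setReg_self ..).trans (hs.trans (if_pos (accept_iff.2 h)))
    · exact (State.reg_setReg_self ..).trans (hs.trans (if_neg (accept_iff.not.2 h)))

theorem exists_program :
    ∃ p c, ∀ I : BInstance, DecidesInTime p I.input (HasBColoring I.G I.k)
      (2 ^ (c * exponent I.k I.delta I.ell) + (I.n + 2) ^ c) := by
  obtain ⟨p, c, hp⟩ := exists_program_searchSize
  refine ⟨p, 14 * c, fun I => (hp I).mono ?_⟩
  set X := exponent I.k I.delta I.ell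
  calc I.searchSize ^ c ≤ (((I.n + 2) * 2 ^ X) ^ 7) ^ c := Nat.pow_le_pow_left searchSize_le c
    _ = (I.n + 2) ^ (7 * c) * (2 ^ X) ^ (7 * c) := by rw [← pow_mul, mul_pow]
    _ ≤ ((2 ^ X) ^ (7 * c)) ^ 2 + ((I.n + 2) ^ (7 * c)) ^ 2 := by
        nlinarith [two_mul_le_add_sq ((I.n + 2) ^ (7 * c)) ((2 ^ X) ^ (7 * c))]
    _ = 2 ^ (14 * c * X) + (I.n + 2) ^ (14 * c) := by ring

theorem exponent_le (k Δ ℓ : ℕ) : exponent k Δ ℓ ≤ (Δ + ℓ + 1) ^ (Δ + ℓ + 5) := by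
  set q := Δ + ℓ
  rw [exponent]
  split
  · calc ℓ * Δ * min ℓ Δ ^ (ℓ + 1) ≤ (q + 1) * (q + 1) * (q + 1) ^ (ℓ + 1) := by gcongr <;> omega
      _ = (q + 1) ^ (ℓ + 3) := by ring
      _ ≤ (q + 1) ^ (q + 5) := Nat.pow_le_pow_right q.succ_pos (by omega)
  · calc min k (Δ + 1) ^ 4 * Δ ≤ (q + 1) ^ 4 * (q + 1) := by gcongr <;> omega
      _ = (q + 1) ^ 5 := (pow_succ _ _).symm
      _ ≤ (q + 1) ^ (q + 5) := Nat.pow_le_pow_right q.succ_pos (by omega)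

theorem add_two_le_two_mul_length (I : BInstance) : I.n + 2 ≤ 2 * I.length := by
  rw [length]
  nlinarith [sq_nonneg ((I.n : ℤ) - 1)]

theorem computable_fptBound (c : ℕ) :
    Computable fun q : ℕ => 2 ^ (c * (q + 1) ^ (q + 5)) + 2 ^ c := by
  have hpow : Primrec₂ fun a b : ℕ => a ^ b := Primrec₂.unpaired'.1 Nat.Primrec.pow
  have hexp : Primrec fun q : ℕ => c * (q + 1) ^ (q + 5) :=
    Primrec.nat_mul.comp (.const c)
      (hpow.comp Primrec.succ (Primrec.nat_add.comp .id (.const 5)))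
  exact (Primrec.nat_add.comp (hpow.comp (.const 2) hexp) (.const (2 ^ c))).to_comp

theorem isFPT : IsFPT input length (fun I => I.delta + I.ell) fun I => HasBColoring I.G I.k := by
  obtain ⟨p, c, hp⟩ := exists_program
  refine ⟨p, fun q => 2 ^ (c * (q + 1) ^ (q + 5)) + 2 ^ c, c, computable_fptBound c,
    fun I => (hp I).mono ?_⟩
  have hlength : 1 ≤ I.length ^ c := Nat.one_le_pow _ _ (Nat.succ_pos _)
  calc 2 ^ (c * exponent I.k I.delta I.ell) + (I.n + 2) ^ c
      ≤ 2 ^ (c * (I.delta + I.ell + 1) ^ (I.delta + I.ell + 5)) * 1 + (2 * I.length) ^ c := by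
        rw [mul_one]
        gcongr
        · exact one_le_two
        · exact exponent_le _ _ _
        · exact I.add_two_le_two_mul_length
    _ ≤ 2 ^ (c * (I.delta + I.ell + 1) ^ (I.delta + I.ell + 5)) * I.length ^ c +
          2 ^ c * I.length ^ c := by
        rw [mul_pow]
        gcongr
    _ = _ := (add_mul _ _ _).symm

end BInstance

theorem mainTheorem9 :
    RAM.IsFPT BInstance.input BInstance.length
      (fun I => maxDeg I.G + numHighDeg I.G I.k) (fun I => HasBColoring I.G I.k) ∧
    ∃ (p : RAM.Program) (c : ℕ), ∀ (n : ℕ) (G : SimpleGraph (Fin n)) (k Δ ℓ : ℕ),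
      Δ = maxDeg G → ℓ = numHighDeg G k →
      (k < ℓ → RAM.DecidesInTime p (BInstance.input ⟨n, G, k⟩) (HasBColoring G k)
        (2 ^ (c * (ℓ * Δ * min ℓ Δ ^ (ℓ + 1))) + (n + 2) ^ c)) ∧
      (ℓ ≤ k → RAM.DecidesInTime p (BInstance.input ⟨n, G, k⟩) (HasBColoring G k)
        (2 ^ (c * (min k (Δ + 1) ^ 4 * Δ)) + (n + 2) ^ c)) := by
  obtain ⟨p, c, hp⟩ := BInstance.exists_program
  refine ⟨BInstance.isFPT, p, c, ?_⟩
  rintro n G k _ _ rfl rfl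
  have hdecides : RAM.DecidesInTime p (BInstance.input ⟨n, G, k⟩) (HasBColoring G k)
      (2 ^ (c * BInstance.exponent k (maxDeg G) (numHighDeg G k)) + (n + 2) ^ c) := hp ⟨n, G, k⟩
  exact ⟨fun hk => BInstance.exponent_of_lt hk ▸ hdecides,
    fun hk => BInstance.exponent_of_le hk ▸ hdecides⟩
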